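/- Let $\Omega\subset\mathbb C^m$ be a domain (a non-empty connected open set), and let $\mathbb B^m\subset\mathbb C^m$ be the open unit ball. Suppose that $\Omega$ is weakly holomorphic homogeneous regular (wHHR): there exists $s>0$ such that for every $\zeta\in\Omega$ there are a holomorphic embedding $\Phi:\mathbb B^m\to\Omega$ with $\Phi(0)=\zeta$ and a $\mathcal C^2$ plurisubharmonic function $\phi:\Omega\to[0,1]$ with $$\sum_{j,k=1}^m\frac{\partial^2(\phi\circ\Phi)}{\partial z^j\partial\bar z^k}(w)\,X_j\overline{X_k}\;\ge\; s^2\|X\|^2\qquad\text{for all } w\in\mathbb B^m,\ X\in\mathbb C^m .$$ Then: (1) $\Omega$ is taut: for every connected (Hausdorff, second countable) complex manifold $N$, every sequence of holomorphic maps $N\to\Omega$ has a subsequence that either converges locally uniformly to a holomorphic map $N\to\Omega$, or is compactly divergent, i.e. for all compact sets $K\subset N$ and $L\subset\Omega$ all but finitely many members $f$ of the subsequence satisfy $f(K)\cap L=\emptyset$. (2) $\Omega$ is pseudoconvex: there is a continuous plurisubharmonic function $u:\Omega\to\mathbb R$ such that $\{z\in\Omega: u(z)\le c\}$ is compact for every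 $c\in\mathbb R$. -/

import Mathlib

universe u

namespace SCV

open scoped Manifold ContDiff

/-- Complex Euclidean space `ℂ^m` with its Euclidean norm. -/
abbrev Cn (m : ℕ) : Type := EuclideanSpace ℂ (Fin m)

/-- The operator `∂/∂z^j = (∂/∂x^j - i ∂/∂y^j) / 2`, where `z^j = x^j + i y^j`. -/
noncomputable def dz {m : ℕ} (j : Fin m) (f : Cn m → ℂ) (z : Cn m) : ℂ :=
  (1 / 2) * (fderiv ℝ f z (EuclideanSpace.single j 1)
    - Complex.I * fderiv ℝ f z (EuclideanSpace.single j Complex.I))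

/-- The operator `∂/∂z̄^k = (∂/∂x^k + i ∂/∂y^k) / 2`. -/
noncomputable def dzbar {m : ℕ} (k : Fin m) (f : Cn m → ℂ) (z : Cn m) : ℂ :=
  (1 / 2) * (fderiv ℝ f z (EuclideanSpace.single k 1)
    + Complex.I * fderiv ℝ f z (EuclideanSpace.single k Complex.I))

/-- The Levi form `∑_{j,k} ∂²f/∂z^j∂z̄^k dz^j ⊗ dz̄^k` of a real valued function at the point `z`,
evaluated at the pair of vectors `(X, Y)`. -/
noncomputable def leviForm {m : ℕ} (f : Cn m → ℝ) (z X Y : Cn m) : ℂ :=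
  ∑ j, ∑ k, dz j (dzbar k fun w => (f w : ℂ)) z * X j * (starRingEnd ℂ) (Y k)

/-- A (finite valued) function is plurisubharmonic on the open set `Ω` if it is upper
semicontinuous there and satisfies the sub-mean value inequality on every closed affine disc
`{a + ζ b : |ζ| ≤ 1}` contained in `Ω`. As `u a > -∞`, that inequality forces the mean value over
the boundary circle to be finite, which is the integrability clause. -/
def PlurisubharmonicOn {m : ℕ} (u : Cn m → ℝ) (Ω : Set (Cn m)) : Prop :=
  UpperSemicontinuousOn u Ω ∧
    ∀ a b : Cn m, (∀ ζ : ℂ, ‖ζ‖ ≤ 1 → a + ζ • b ∈ Ω) →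
      CircleIntegrable (fun ζ : ℂ => u (a + ζ • b)) 0 1 ∧
        u a ≤ Real.circleAverage (fun ζ : ℂ => u (a + ζ • b)) 0 1

/-- `Φ` restricts to a holomorphic embedding of the open unit ball of `ℂ^m` into `Ω`: a holomorphic
immersion that is a homeomorphism onto its image. -/
structure IsHolomorphicBallEmbedding {m : ℕ} (Φ : Cn m → Cn m) (Ω : Set (Cn m)) : Prop where
  mapsTo : Set.MapsTo Φ (Metric.ball 0 1) Ω
  differentiableOn : DifferentiableOn ℂ Φ (Metric.ball 0 1)
  immersion : ∀ w ∈ Metric.ball (0 : Cn m) 1, Function.Injective (fderiv ℂ Φ w)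
  isEmbedding : Topology.IsEmbedding ((Metric.ball (0 : Cn m) 1).domRestrict Φ)

/-- Weakly holomorphic homogeneous regular domains in `ℂ^m`. -/
structure IsWHHRDomain {m : ℕ} (Ω : Set (Cn m)) : Prop where
  isOpen : IsOpen Ω
  isConnected : IsConnected Ω
  exists_bound : ∃ s : ℝ, 0 < s ∧ ∀ p ∈ Ω, ∃ (Φ : Cn m → Cn m) (φ : Cn m → ℝ),
    IsHolomorphicBallEmbedding Φ Ω ∧ Φ 0 = p ∧
    ContDiffOn ℝ 2 φ Ω ∧ PlurisubharmonicOn φ Ω ∧ Set.MapsTo φ Ω (Set.Icc 0 1) ∧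
    ∀ w ∈ Metric.ball (0 : Cn m) 1, ∀ X : Cn m,
      s ^ 2 * ‖X‖ ^ 2 ≤ (leviForm (φ ∘ Φ) w X X).re

/-- The set of holomorphic maps from a complex manifold `N` of dimension `k` to `Ω`. -/
def holomorphicMaps (k : ℕ) (N : Type*) [TopologicalSpace N] [ChartedSpace (Cn k) N] {m : ℕ}
    (Ω : Set (Cn m)) : Set (N → Cn m) :=
  {f | MDifferentiable 𝓘(ℂ, Cn k) 𝓘(ℂ, Cn m) f ∧ ∀ x, f x ∈ Ω}

/-- `Ω` is taut: for every connected complex manifold `N`, the holomorphic maps `N → Ω` form a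
normal family, that is, every sequence of them has a subsequence that converges locally uniformly
to a holomorphic map `N → Ω` or that is compactly divergent. -/
def IsTaut {m : ℕ} (Ω : Set (Cn m)) : Prop :=
  ∀ (k : ℕ) (N : Type u) [TopologicalSpace N] [ChartedSpace (Cn k) N]
    [IsManifold 𝓘(ℂ, Cn k) ω N] [T2Space N] [SecondCountableTopology N] [ConnectedSpace N]
    (f : ℕ → N → Cn m), (∀ n, f n ∈ holomorphicMaps k N Ω) →
    ∃ σ : ℕ → ℕ, StrictMono σ ∧
      ((∃ g ∈ holomorphicMaps k N Ω,
          TendstoLocallyUniformly (fun n => f (σ n)) g Filter.atTop) ∨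
        ∀ K : Set N, IsCompact K → ∀ L : Set (Cn m), IsCompact L → L ⊆ Ω →
          ∀ᶠ n in Filter.atTop, Disjoint (f (σ n) '' K) L)

/-- `Ω` is pseudoconvex: it is open and carries a continuous plurisubharmonic exhaustion
function. -/
def IsPseudoconvex {m : ℕ} (Ω : Set (Cn m)) : Prop :=
  IsOpen Ω ∧ ∃ u : Cn m → ℝ, ContinuousOn u Ω ∧ PlurisubharmonicOn u Ω ∧
    ∀ c : ℝ, IsCompact {z ∈ Ω | u z ≤ c}

end SCV

/-! Both conclusions follow from one uniform localization property (`HasLocalization`): there is a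
radius `c > 0`, depending only on `s`, such that holomorphic discs in `Ω` with centre in a given
compact set `L` map `|ζ| < c` into a compact set `L' ⊂ Ω` depending only on `L`.

To obtain it, take a chart `Φ` with its function `φ`, and `w₀` with `‖w₀‖ < 1/2`. The function `t
e^{-128 t}` with `t = ‖Φ⁻¹ q - w₀‖²` has logarithm `log t - 128 t`, and the negative Levi form of
`-128 t` is compensated by `(128 / s²) φ`. A maximum with a constant extends `t e^{-128 t}` to
`glueFun` on all of `Ω`; outside the chart the weak plurisubharmonicity of `φ` is enough. For a disc
`f` with `f 0 = Φ w₀`, the quotient `glueFun (f ζ) · exp ((128 / s²) φ (f ζ) + |ζ|²) / |ζ|` extends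
by `0` to the origin and has no positive local maximum elsewhere, since `|ζ|²` makes the logarithm
strictly subharmonic. Its bound on `|ζ| = 1/2` therefore holds inside (`IsWHHRChart.glueFun_le`).
Hence `glueFun (f ζ) = O(|ζ|)` with a constant depending only on `s`, and `f` cannot leave the chart
quickly. Finitely many charts cover `L`.

Tautness: a sequence that is not compactly divergent has a subsequence bounded in `Ω` near one
point. As `c` does not depend on the compact set, such bounds propagate over a connected manifold by
an open-closed argument, and Montel's theorem applies. The limit stays in `Ω` because the bounds are
compact subsets of `Ω`.

Pseudoconvexity: the same propagation gives Hartogs' continuity principle for families of discs,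
hence the sub-mean value inequality for `-log dist(·, Ωᶜ)`. Adding `‖z‖²` produces the exhaustion.
-/

open Filter Metric Set
open scoped Topology ContDiff Manifold

namespace SCV

/-! ### Holomorphic maps between complex normed spaces: limits, derivatives, smoothness -/

section Holomorphic

variable {E F : Type*} [NormedAddCommGroup E] [NormedSpace ℂ E] [NormedAddCommGroup F]
  [NormedSpace ℂ F]

/-- **Cauchy estimate** for the derivative of a bounded holomorphic map on a ball. -/
theorem norm_fderiv_le_of_norm_le {f : E → F} {x : E} {r M : ℝ} (hr : 0 < r)
    (hf : DifferentiableOn ℂ f (ball x r)) (hM : ∀ z ∈ ball x r, ‖f z‖ ≤ M) :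
    ‖fderiv ℂ f x‖ ≤ 2 * M / r := by
  refine Complex.norm_fderiv_le_div_of_mapsTo_ball hf (fun z hz => ?_) hr
  rw [mem_closedBall, dist_eq_norm, two_mul]
  exact (norm_sub_le _ _).trans (add_le_add (hM z hz) (hM x (mem_ball_self hr)))

/-- The limit of a sequence of holomorphic maps that converges uniformly on a ball is holomorphic
at the centre of the ball. -/
theorem differentiableAt_of_tendstoUniformlyOn_ball [CompleteSpace F] {x : E} {R : ℝ} (hR : 0 < R)
    {f : ℕ → E → F} {g : E → F} (hf : ∀ n, DifferentiableOn ℂ (f n) (ball x R))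
    (h : TendstoUniformlyOn f g atTop (ball x R)) : DifferentiableAt ℂ g x := by
  set r := R / 2 with hrdef
  have hr : 0 < r := by positivity
  have hsub : ∀ z ∈ ball x r, ball z r ⊆ ball x R := fun z hz =>
    ball_subset_ball' (by have := mem_ball.1 hz; linarith)
  -- The Cauchy estimate on balls of radius `r` with bound `ε r / 4` gives `ε / 2 < ε` for the
  -- derivatives.
  have hC : UniformCauchySeqOn (fun n => fderiv ℂ (f n)) atTop (ball x r) := by
    have hc := h.uniformCauchySeqOn
    rw [Metric.uniformCauchySeqOn_iff] at hc ⊢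
    intro ε hε
    obtain ⟨N, hN⟩ := hc (ε * r / 4) (by positivity)
    refine ⟨N, fun n hn k hk z hz => ?_⟩
    have hdf : ∀ n, DifferentiableOn ℂ (f n) (ball z r) := fun n => (hf n).mono (hsub z hz)
    have hda : ∀ n, DifferentiableAt ℂ (f n) z := fun n =>
      (hdf n).differentiableAt (ball_mem_nhds z hr)
    have hb := norm_fderiv_le_of_norm_le hr ((hdf n).sub (hdf k)) (M := ε * r / 4)
      fun w hw => by
        rw [Pi.sub_apply, ← dist_eq_norm]
        exact (hN n hn k hk w (hsub z hz hw)).le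
    rw [fderiv_sub (hda n) (hda k)] at hb
    rw [dist_eq_norm]
    refine hb.trans_lt ?_
    rw [div_lt_iff₀ hr]
    nlinarith [mul_pos hε hr]
  choose! g' hg' using fun z (hz : z ∈ ball x r) =>
    cauchySeq_tendsto_of_complete (hC.cauchySeq hz)
  have hU := hC.tendstoUniformlyOn_of_tendsto hg'
  refine (hasFDerivAt_of_tendstoUniformlyOn (f := f) isOpen_ball hU (fun n z hz => ?_) (fun z hz => ?_)
    (mem_ball_self hr)).differentiableAt
  · exact (((hf n).mono (hsub z hz)).differentiableAt (ball_mem_nhds z hr)).hasFDerivAt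
  · exact h.tendsto_at (hsub z hz (mem_ball_self hr))

/-- The directional derivatives of a holomorphic map are holomorphic. -/
theorem differentiableOn_fderiv_apply [CompleteSpace F] {U : Set E} (hU : IsOpen U) {f : E → F}
    (hf : DifferentiableOn ℂ f U) (v : E) : DifferentiableOn ℂ (fun z => fderiv ℂ f z v) U := by
  intro x hx
  refine DifferentiableAt.differentiableWithinAt ?_
  obtain ⟨ρ, hρ, hρU⟩ : ∃ ρ > 0, ball x ρ ⊆ U ∩ f ⁻¹' ball (f x) 1 :=
    Metric.mem_nhds_iff.1 (inter_mem (hU.mem_nhds hx)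
      ((hf.continuousOn.continuousAt (hU.mem_nhds hx)).preimage_mem_nhds
        (ball_mem_nhds _ one_pos)))
  set r := ρ / 2 with hrdef
  have hr : 0 < r := by positivity
  set R := r / (1 + ‖v‖) with hRdef
  have hv : 0 < 1 + ‖v‖ := by positivity
  have hR : 0 < R := by positivity
  have hmem : ∀ z ∈ ball x r, ∀ ζ ∈ ball (0 : ℂ) R, z + ζ • v ∈ ball x ρ := by
    intro z hz ζ hζ
    rw [mem_ball_zero_iff] at hζ
    rw [mem_ball, dist_eq_norm] at hz ⊢
    have h1 : ‖ζ • v‖ ≤ R * (1 + ‖v‖) := by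
      rw [norm_smul]
      exact mul_le_mul hζ.le (by linarith) (norm_nonneg _) hR.le
    rw [hRdef, div_mul_cancel₀ _ hv.ne'] at h1
    calc ‖z + ζ • v - x‖ = ‖(z - x) + ζ • v‖ := by congr 1; abel
      _ ≤ ‖z - x‖ + ‖ζ • v‖ := norm_add_le _ _
      _ < ρ := by linarith
  -- Difference quotients with steps `t n → 0` are holomorphic in `z`; the `+ 2` keeps every step,
  -- including the one for `n = 0`, strictly inside the disc of radius `R`.
  set t : ℕ → ℂ := fun n => ((R / (n + 2) : ℝ) : ℂ) with ht
  have htn : ∀ n, ‖t n‖ = R / (n + 2) := fun n => by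
    rw [ht]; simp only [Complex.norm_real, Real.norm_eq_abs]
    exact abs_of_pos (by positivity)
  have htmem : ∀ n, t n ∈ ball (0 : ℂ) R := fun n => by
    rw [mem_ball_zero_iff, htn]
    exact div_lt_self hR (by have : (0 : ℝ) ≤ n := n.cast_nonneg; linarith)
  have ht0 : ∀ n, t n ≠ 0 := fun n => by
    rw [← norm_ne_zero_iff, htn]; positivity
  have hdiff : DifferentiableOn ℂ f (ball x ρ) := hf.mono fun z hz => (hρU hz).1
  refine differentiableAt_of_tendstoUniformlyOn_ball hr
    (f := fun n z => (t n)⁻¹ • (f (z + t n • v) - f z)) (fun n => ?_) ?_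
  · refine (DifferentiableOn.sub ?_ ?_).const_smul _
    · refine hdiff.comp (by fun_prop) fun z hz => hmem z hz _ (htmem n)
    · exact hdiff.mono (ball_subset_ball (by linarith))
  -- The Schwarz lemma is used twice: it bounds `dslope h 0` by `2 / R`, and then the variation of
  -- `dslope h 0` by `(4 / R) / R * ‖t n‖`, uniformly in `z`.
  · have hest : ∀ n, ∀ z ∈ ball x r,
        dist (fderiv ℂ f z v) ((t n)⁻¹ • (f (z + t n • v) - f z)) ≤ 4 / R / R * ‖t n‖ := by
      intro n z hz
      set h : ℂ → F := fun ζ => f (z + ζ • v) with hh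
      have hhd : DifferentiableOn ℂ h (ball 0 R) :=
        hdiff.comp (by fun_prop) fun ζ hζ => hmem z hz ζ hζ
      have hmaps : MapsTo h (ball 0 R) (closedBall (h 0) 2) := by
        intro ζ hζ
        have h1 := (hρU (hmem z hz ζ hζ)).2
        have h2 := (hρU (hmem z hz 0 (mem_ball_self hR))).2
        rw [mem_preimage, mem_ball] at h1 h2
        rw [mem_closedBall]
        have := dist_triangle_right (h ζ) (h 0) (f x)
        simp only [hh] at this ⊢
        linarith
      have hds : DifferentiableOn ℂ (dslope h 0) (ball 0 R) :=
        (Complex.differentiableOn_dslope (ball_mem_nhds 0 hR)).2 hhd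
      have hb := fun ζ hζ => Complex.norm_dslope_le_div_of_mapsTo_ball hhd hmaps (z := ζ) hζ
      have hmaps' : MapsTo (dslope h 0) (ball 0 R) (closedBall (dslope h 0 0) (4 / R)) := by
        intro ζ hζ
        rw [mem_closedBall, dist_eq_norm]
        have := norm_sub_le (dslope h 0 ζ) (dslope h 0 0)
        have h1 := hb ζ hζ
        have h2 := hb 0 (mem_ball_self hR)
        calc _ ≤ _ := this
          _ ≤ 2 / R + 2 / R := add_le_add h1 h2
          _ = 4 / R := by ring
      have hfin := Complex.dist_le_div_mul_dist_of_mapsTo_ball hds hmaps' (htmem n)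
      rw [dist_zero_right, dist_comm] at hfin
      have e0 : dslope h 0 0 = fderiv ℂ f z v := by
        rw [dslope_same]
        have hz' : z ∈ ball x ρ := ball_subset_ball (by linarith) hz
        have hfz : HasFDerivAt f (fderiv ℂ f z) (z + (0 : ℂ) • v) := by
          rw [zero_smul, add_zero]
          exact (hdiff.differentiableAt (isOpen_ball.mem_nhds hz')).hasFDerivAt
        have hl : HasDerivAt (fun ζ : ℂ => z + ζ • v) v 0 := by
          simpa using ((hasDerivAt_id (0 : ℂ)).smul_const v).const_add z
        exact (hfz.comp_hasDerivAt (0 : ℂ) hl).deriv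
      have e1 : dslope h 0 (t n) = (t n)⁻¹ • (f (z + t n • v) - f z) := by
        rw [dslope_of_ne _ (ht0 n), slope_def_module]
        simp [hh]
      rwa [e0, e1] at hfin
    rw [Metric.tendstoUniformlyOn_iff]
    intro ε hε
    have hlim : Tendsto (fun n : ℕ => 4 / R / R * ‖t n‖) atTop (𝓝 0) := by
      have h1 : Tendsto (fun n : ℕ => R / ((n : ℝ) + 2)) atTop (𝓝 0) :=
        Tendsto.div_atTop tendsto_const_nhds
          (tendsto_atTop_add_const_right _ _ tendsto_natCast_atTop_atTop)
      simpa [htn] using h1.const_mul (4 / R / R)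
    filter_upwards [hlim.eventually (gt_mem_nhds hε)] with n hn z hz
    exact (hest n z hz).trans_lt hn

/-- Holomorphic maps on open subsets of finite-dimensional spaces are smooth. -/
theorem contDiffOn_of_differentiableOn [CompleteSpace F] [FiniteDimensional ℂ E] {U : Set E}
    (hU : IsOpen U) (n : ℕ) {f : E → F} (hf : DifferentiableOn ℂ f U) : ContDiffOn ℂ n f U := by
  induction n generalizing f with
  | zero => exact contDiffOn_zero.2 hf.continuousOn
  | succ n ih =>
    push_cast
    rw [contDiffOn_succ_iff_fderiv_of_isOpen hU]
    refine ⟨hf, by simp, contDiffOn_clm_apply.2 fun v => ih (differentiableOn_fderiv_apply hU hf v)⟩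

end Holomorphic

/-- A holomorphic map with injective derivative between spaces of the same dimension has an
invertible strict derivative. -/
theorem exists_equiv_hasStrictFDerivAt {E : Type*} [NormedAddCommGroup E] [NormedSpace ℂ E]
    [FiniteDimensional ℂ E] {f : E → E} {U : Set E} (hU : IsOpen U) (hf : DifferentiableOn ℂ f U)
    {x : E} (hx : x ∈ U) (hi : Function.Injective (fderiv ℂ f x)) :
    ∃ e : E ≃L[ℂ] E, HasStrictFDerivAt f (e : E →L[ℂ] E) x := by
  have : CompleteSpace E := FiniteDimensional.complete ℂ E
  have hs : HasStrictFDerivAt f (fderiv ℂ f x) x :=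
    ((contDiffOn_of_differentiableOn hU 1 hf).contDiffAt (hU.mem_nhds hx)).hasStrictFDerivAt
      (by simp)
  refine ⟨(LinearEquiv.ofInjectiveEndo (fderiv ℂ f x : E →ₗ[ℂ] E) hi).toContinuousLinearEquiv, ?_⟩
  convert hs using 1
  ext y
  simp

/-! ### Ball embeddings: open image and holomorphic inverse -/

namespace IsHolomorphicBallEmbedding

variable {m : ℕ} {Φ : Cn m → Cn m} {Ω : Set (Cn m)}

theorem injOn (h : IsHolomorphicBallEmbedding Φ Ω) : InjOn Φ (ball 0 1) :=
  injOn_iff_injective.2 h.isEmbedding.injective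

theorem contDiffAt (h : IsHolomorphicBallEmbedding Φ Ω) {w : Cn m} (hw : w ∈ ball (0 : Cn m) 1) :
    ContDiffAt ℝ 2 Φ w :=
  ((contDiffOn_of_differentiableOn isOpen_ball 2 h.differentiableOn).contDiffAt
    (isOpen_ball.mem_nhds hw)).restrict_scalars ℝ

theorem isOpen_image (h : IsHolomorphicBallEmbedding Φ Ω) {V : Set (Cn m)} (hV : IsOpen V)
    (hVB : V ⊆ ball 0 1) : IsOpen (Φ '' V) := by
  rw [isOpen_iff_mem_nhds]
  rintro _ ⟨w, hw, rfl⟩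
  obtain ⟨e, he⟩ := exists_equiv_hasStrictFDerivAt isOpen_ball h.differentiableOn (hVB hw)
    (h.immersion w (hVB hw))
  rw [← he.map_nhds_eq_of_equiv]
  exact image_mem_map (hV.mem_nhds hw)

theorem invFunOn_apply (h : IsHolomorphicBallEmbedding Φ Ω) {w : Cn m}
    (hw : w ∈ ball (0 : Cn m) 1) : Function.invFunOn Φ (ball 0 1) (Φ w) = w :=
  h.injOn.leftInvOn_invFunOn hw

theorem differentiableAt_invFunOn (h : IsHolomorphicBallEmbedding Φ Ω) {w : Cn m}
    (hw : w ∈ ball (0 : Cn m) 1) :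
    DifferentiableAt ℂ (Function.invFunOn Φ (ball 0 1)) (Φ w) := by
  obtain ⟨e, he⟩ := exists_equiv_hasStrictFDerivAt isOpen_ball h.differentiableOn hw
    (h.immersion w hw)
  refine (he.to_local_left_inverse ?_).hasFDerivAt.differentiableAt
  filter_upwards [isOpen_ball.mem_nhds hw] with x hx using h.invFunOn_apply hx

end IsHolomorphicBallEmbedding

/-! ### The Levi form through real second derivatives -/

section RealLevi

variable {E : Type*} [NormedAddCommGroup E] [NormedSpace ℂ E]

/-- Four times the Levi form of a twice differentiable function `f`, expressed through the real
second derivative: `D²f(X, X) + D²f(iX, iX)`. -/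
noncomputable def realLevi (f : E → ℝ) (z X : E) : ℝ :=
  fderiv ℝ (fderiv ℝ f) z X X + fderiv ℝ (fderiv ℝ f) z (Complex.I • X) (Complex.I • X)

theorem differentiableAt_fderiv_of_contDiffAt {G H : Type*} [NormedAddCommGroup G]
    [NormedSpace ℝ G] [NormedAddCommGroup H] [NormedSpace ℝ H] {f : G → H} {z : G}
    (hf : ContDiffAt ℝ 2 f z) : DifferentiableAt ℝ (fderiv ℝ f) z :=
  (hf.fderiv_right (m := 1) (by norm_num)).differentiableAt (by norm_num)

theorem eventually_differentiableAt_of_contDiffAt {G H : Type*} [NormedAddCommGroup G]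
    [NormedSpace ℝ G] [NormedAddCommGroup H] [NormedSpace ℝ H] {f : G → H} {z : G}
    (hf : ContDiffAt ℝ 2 f z) : ∀ᶠ w in 𝓝 z, DifferentiableAt ℝ f w :=
  (hf.eventually (by simp)).mono fun _ h => h.differentiableAt (by norm_num)

theorem realLevi_add {f g : E → ℝ} {z : E} (hf : ContDiffAt ℝ 2 f z) (hg : ContDiffAt ℝ 2 g z)
    (X : E) : realLevi (fun w => f w + g w) z X = realLevi f z X + realLevi g z X := by
  have h : fderiv ℝ (fun w => f w + g w) =ᶠ[𝓝 z] fun w => fderiv ℝ f w + fderiv ℝ g w := by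
    filter_upwards [eventually_differentiableAt_of_contDiffAt hf,
      eventually_differentiableAt_of_contDiffAt hg] with w h1 h2 using fderiv_fun_add h1 h2
  simp only [realLevi]
  rw [h.fderiv_eq, fderiv_fun_add (differentiableAt_fderiv_of_contDiffAt hf)
    (differentiableAt_fderiv_of_contDiffAt hg)]
  simp only [add_apply]
  ring

theorem realLevi_const_mul {f : E → ℝ} {z : E} (hf : ContDiffAt ℝ 2 f z) (c : ℝ) (X : E) :
    realLevi (fun w => c * f w) z X = c * realLevi f z X := by
  have h : fderiv ℝ (fun w => c * f w) =ᶠ[𝓝 z] fun w => c • fderiv ℝ f w := by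
    filter_upwards [eventually_differentiableAt_of_contDiffAt hf] with w h1
      using fderiv_const_mul h1 c
  simp only [realLevi]
  rw [h.fderiv_eq, fderiv_fun_const_smul (differentiableAt_fderiv_of_contDiffAt hf)]
  simp only [smul_apply, smul_eq_mul]
  ring

theorem realLevi_congr {f g : E → ℝ} {z : E} (h : f =ᶠ[𝓝 z] g) (X : E) :
    realLevi f z X = realLevi g z X := by
  simp only [realLevi, h.fderiv.fderiv_eq]

/-- The Levi form is invariant under composition with holomorphic curves. -/
theorem realLevi_comp_analyticAt [CompleteSpace E] {F : E → ℝ} {g : ℂ → E} {ζ : ℂ}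
    (hF : ContDiffAt ℝ 2 F (g ζ)) (hg : AnalyticAt ℂ g ζ) :
    realLevi (fun z => F (g z)) ζ 1 = realLevi F (g ζ) (deriv g ζ) := by
  have hgC : ContDiffAt ℝ 2 g ζ := hg.contDiffAt.restrict_scalars ℝ
  have hcomp : ContDiffAt ℝ 2 (fun z => F (g z)) ζ := hF.comp ζ hgC
  have hg1 : HasFDerivAt g ((fderiv ℂ g ζ).restrictScalars ℝ) ζ :=
    hg.differentiableAt.hasFDerivAt.restrictScalars ℝ
  have hg2 : HasFDerivAt (deriv g) ((fderiv ℂ (deriv g) ζ).restrictScalars ℝ) ζ :=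
    hg.deriv.differentiableAt.hasFDerivAt.restrictScalars ℝ
  -- The term with `g''` carries the factor `v²`, which is `1` for `v = 1` and `-1` for `v = I`, so
  -- it cancels in the sum.
  have key : ∀ v : ℂ, fderiv ℝ (fderiv ℝ (fun z => F (g z))) ζ v v =
      fderiv ℝ (fderiv ℝ F) (g ζ) (v • deriv g ζ) (v • deriv g ζ) +
        fderiv ℝ F (g ζ) ((v * v) • deriv (deriv g) ζ) := by
    intro v
    have h1 : (fun z => fderiv ℝ (fun z => F (g z)) z v) =ᶠ[𝓝 ζ]
        fun z => fderiv ℝ F (g z) (v • deriv g z) := by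
      filter_upwards [hg.eventually_analyticAt,
        hg.continuousAt.eventually (eventually_differentiableAt_of_contDiffAt hF)] with z h1 h2
      have h3 : HasFDerivAt g ((fderiv ℂ g z).restrictScalars ℝ) z :=
        h1.differentiableAt.hasFDerivAt.restrictScalars ℝ
      have h4 := (h2.hasFDerivAt.comp z h3).fderiv
      rw [show (fun z => F (g z)) = F ∘ g from rfl, h4]
      simp
    have h2 : HasFDerivAt (fun z => fderiv ℝ (fun z => F (g z)) z v)
        ((fderiv ℝ (fderiv ℝ fun z => F (g z)) ζ).flip v) ζ :=
      ((differentiableAt_fderiv_of_contDiffAt hcomp).hasFDerivAt.clm_apply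
        (hasFDerivAt_const v ζ)).congr_fderiv (by ext; simp)
    have h3 := ((differentiableAt_fderiv_of_contDiffAt hF).hasFDerivAt.comp ζ hg1).clm_apply
      (hg2.const_smul v)
    have h4 := h2.unique (h3.congr_of_eventuallyEq h1)
    have h5 := congrArg (fun L : ℂ →L[ℝ] ℝ => L v) h4
    simpa [mul_smul, add_comm] using h5
  simp only [realLevi, key, one_smul, smul_eq_mul, mul_one, Complex.I_mul_I, neg_smul,
    map_neg]
  ring

theorem realLevi_nonpos_of_isLocalMax {h : ℂ → ℝ} {ζ : ℂ} (hh : ContDiffAt ℝ 2 h ζ)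
    (hmax : IsLocalMax h ζ) : realLevi h ζ 1 ≤ 0 := by
  have key : ∀ v : ℂ, fderiv ℝ (fderiv ℝ h) ζ v v ≤ 0 := by
    intro v
    by_contra! hpos
    set k : ℝ → ℝ := fun t => h (ζ + t • v) with hk
    have hl : ∀ t : ℝ, HasDerivAt (fun t : ℝ => ζ + t • v) v t := fun t => by
      simpa using ((hasDerivAt_id t).smul_const v).const_add ζ
    have hl0 : Tendsto (fun t : ℝ => ζ + t • v) (𝓝 0) (𝓝 ζ) := by
      simpa using (hl 0).continuousAt.tendsto
    have hk1 : ∀ᶠ t in 𝓝 (0 : ℝ), HasDerivAt k (fderiv ℝ h (ζ + t • v) v) t := by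
      filter_upwards [hl0.eventually (eventually_differentiableAt_of_contDiffAt hh)] with t ht
      exact ht.hasFDerivAt.comp_hasDerivAt t (hl t)
    have hk2 : HasDerivAt (fun t : ℝ => fderiv ℝ h (ζ + t • v) v)
        (fderiv ℝ (fderiv ℝ h) ζ v v) 0 := by
      have h0 : HasFDerivAt (fderiv ℝ h) (fderiv ℝ (fderiv ℝ h) ζ) (ζ + (0 : ℝ) • v) := by
        rw [zero_smul, add_zero]; exact (differentiableAt_fderiv_of_contDiffAt hh).hasFDerivAt
      exact ((ContinuousLinearMap.apply ℝ ℝ v).hasFDerivAt).comp_hasDerivAt (0 : ℝ)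
        (h0.comp_hasDerivAt (0 : ℝ) (hl 0))
    have hdk : deriv k =ᶠ[𝓝 0] fun t : ℝ => fderiv ℝ h (ζ + t • v) v :=
      hk1.mono fun t ht => ht.deriv
    have hddk : deriv (deriv k) 0 = fderiv ℝ (fderiv ℝ h) ζ v v := by
      rw [hdk.deriv_eq, hk2.deriv]
    have hkmax : IsLocalMax k 0 := by
      filter_upwards [hl0.eventually hmax] with t ht
      simpa [hk] using ht
    -- A positive second derivative would make `0` a local minimum as well as a maximum; then `k` is
    -- locally constant and its second derivative vanishes.
    have hkmin : IsLocalMin k 0 := isLocalMin_of_deriv_deriv_pos (hddk ▸ hpos)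
      hkmax.deriv_eq_zero hk1.self_of_nhds.continuousAt
    have hconst : k =ᶠ[𝓝 0] fun _ => k 0 := by
      filter_upwards [hkmax, hkmin] with t h1 h2 using le_antisymm h1 h2
    have : deriv (deriv k) 0 = 0 := by
      rw [hconst.deriv.deriv_eq]; simp
    linarith
  have := add_le_add (key 1) (key (Complex.I • 1))
  simpa [realLevi] using this

/-- In one variable `realLevi h ζ 1` is the Laplacian of `h`. -/
theorem realLevi_eq_zero_of_harmonicAt {h : ℂ → ℝ} {ζ : ℂ}
    (hh : InnerProductSpace.HarmonicAt h ζ) : realLevi h ζ 1 = 0 := by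
  have := hh.2.self_of_nhds
  rw [InnerProductSpace.laplacian_eq_iteratedFDeriv_complexPlane] at this
  simpa [iteratedFDeriv_two_apply, realLevi] using this

end RealLevi

section NormSq

variable {E : Type*} [NormedAddCommGroup E] [InnerProductSpace ℂ E]

theorem contDiff_norm_sub_sq (w₀ : E) : ContDiff ℝ 2 fun w : E => ‖w - w₀‖ ^ 2 := by
  let _ : InnerProductSpace ℝ E := InnerProductSpace.complexToReal
  exact (contDiff_id.sub contDiff_const).norm_sq ℝ

theorem realLevi_norm_sub_sq (w₀ z X : E) :
    realLevi (fun w : E => ‖w - w₀‖ ^ 2) z X = 4 * ‖X‖ ^ 2 := by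
  let _ : InnerProductSpace ℝ E := InnerProductSpace.complexToReal
  have h1 : fderiv ℝ (fun w : E => ‖w - w₀‖ ^ 2) = fun w => 2 • innerSL ℝ (w - w₀) := by
    ext1 w
    simpa using ((hasFDerivAt_id (𝕜 := ℝ) w).sub_const w₀).norm_sq.fderiv
  have h2 : fderiv ℝ (fderiv ℝ fun w : E => ‖w - w₀‖ ^ 2) z = 2 • innerSL ℝ := by
    rw [h1]
    refine HasFDerivAt.fderiv ?_
    have := ((innerSL ℝ (E := E)).hasFDerivAt (x := z - w₀)).comp z
      ((hasFDerivAt_id (𝕜 := ℝ) z).sub_const w₀)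
    exact this.const_smul (2 : ℕ)
  have h3 : ∀ Y : E, (2 • innerSL ℝ (E := E)) Y Y = 2 * ‖Y‖ ^ 2 := fun Y => by
    rw [← real_inner_self_eq_norm_sq]; simp
  rw [realLevi, h2, h3, h3, norm_smul, Complex.norm_I]
  ring

end NormSq

section LeviForm

variable {m : ℕ}

theorem sum_mul_wirtinger (L : Cn m →L[ℝ] ℂ) (X : Cn m) :
    ∑ j, X j * ((1 / 2) * (L (EuclideanSpace.single j 1)
      - Complex.I * L (EuclideanSpace.single j Complex.I))) =
      (1 / 2) * (L X - Complex.I * L (Complex.I • X)) := by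
  have hL : ∀ Y : Cn m, L Y = ∑ j, (((Y j).re : ℂ) * L (EuclideanSpace.single j 1) +
      ((Y j).im : ℂ) * L (EuclideanSpace.single j Complex.I)) := by
    intro Y
    have hY : Y = ∑ j, ((Y j).re • EuclideanSpace.single j (1 : ℂ) +
        (Y j).im • EuclideanSpace.single j Complex.I) := by
      ext i
      simp only [PiLp.add_apply, PiLp.single_apply, WithLp.ofLp_sum,
        Finset.sum_apply, WithLp.ofLp_smul, Pi.smul_apply,
        Finset.sum_add_distrib]
      simp [Complex.re_add_im]
    conv_lhs => rw [hY]
    simp only [map_sum, map_add, map_smul, Complex.real_smul]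
  rw [hL X, hL (Complex.I • X), Finset.mul_sum, ← Finset.sum_sub_distrib, Finset.mul_sum]
  refine Finset.sum_congr rfl fun j _ => ?_
  have h1 : ((Complex.I • X) j).re = -(X j).im := by simp
  have h2 : ((Complex.I • X) j).im = (X j).re := by simp
  rw [h1, h2]
  conv_lhs => rw [← Complex.re_add_im (X j)]
  push_cast
  linear_combination (-(1 / 2) * ((X j).im : ℂ) * L (EuclideanSpace.single j Complex.I)) *
    Complex.I_sq

theorem sum_mul_conj_wirtinger (L : Cn m →L[ℝ] ℂ) (X : Cn m) :
    ∑ k, ((1 / 2) * (L (EuclideanSpace.single k 1)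
      + Complex.I * L (EuclideanSpace.single k Complex.I))) * (starRingEnd ℂ) (X k) =
      (1 / 2) * (L X + Complex.I * L (Complex.I • X)) := by
  -- The identity for `∂/∂z̄` is the conjugate of the one for `∂/∂z` applied to the conjugate of
  -- `L`.
  have h := congrArg (starRingEnd ℂ) (sum_mul_wirtinger
    ((Complex.conjCLE : ℂ →L[ℝ] ℂ).comp L) X)
  simp only [map_sum, map_mul, map_sub, ContinuousLinearMap.comp_apply,
    ContinuousLinearEquiv.coe_coe, Complex.conjCLE_apply, Complex.conj_conj, Complex.conj_I,
    map_div₀, map_one, map_ofNat, neg_mul, sub_neg_eq_add] at h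
  rw [← h]
  exact Finset.sum_congr rfl fun k _ => mul_comm _ _

/-- The Levi form in terms of the real second derivative. -/
theorem re_leviForm_self {f : Cn m → ℝ} {z : Cn m} (hf : ContDiffAt ℝ 2 f z) (X : Cn m) :
    (leviForm f z X X).re = realLevi f z X / 4 := by
  set F : Cn m → ℂ := fun w => (f w : ℂ) with hF
  have hFC : ContDiffAt ℝ 2 F z := Complex.ofRealCLM.contDiff.contDiffAt.comp z hf
  have hd := differentiableAt_fderiv_of_contDiffAt hFC
  have hdz : ∀ k, HasFDerivAt (dzbar k F) ((1 / 2 : ℂ) •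
      ((fderiv ℝ (fderiv ℝ F) z).flip (EuclideanSpace.single k 1) +
        Complex.I • (fderiv ℝ (fderiv ℝ F) z).flip (EuclideanSpace.single k Complex.I))) z := by
    intro k
    have h1 : ∀ v, HasFDerivAt (fun w => fderiv ℝ F w v) ((fderiv ℝ (fderiv ℝ F) z).flip v) z :=
      fun v => (hd.hasFDerivAt.clm_apply (hasFDerivAt_const v z)).congr_fderiv (by ext; simp)
    exact ((h1 _).add ((h1 _).const_mul Complex.I)).const_mul (1 / 2)
  have hB : ∀ u v, fderiv ℝ (fderiv ℝ F) z u v = (fderiv ℝ (fderiv ℝ f) z u v : ℂ) := by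
    intro u v
    have h1 : fderiv ℝ F =ᶠ[𝓝 z] fun w => Complex.ofRealCLM.comp (fderiv ℝ f w) := by
      filter_upwards [eventually_differentiableAt_of_contDiffAt hf] with w hw
      exact (Complex.ofRealCLM.hasFDerivAt.comp w hw.hasFDerivAt).fderiv
    have h2 : HasFDerivAt (fun w => Complex.ofRealCLM.comp (fderiv ℝ f w))
        (((ContinuousLinearMap.compL ℝ (Cn m) ℝ ℂ) Complex.ofRealCLM).comp
          (fderiv ℝ (fderiv ℝ f) z)) z :=
      ((ContinuousLinearMap.compL ℝ (Cn m) ℝ ℂ) Complex.ofRealCLM).hasFDerivAt.comp z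
        (differentiableAt_fderiv_of_contDiffAt hf).hasFDerivAt
    rw [h1.fderiv_eq, h2.fderiv]
    simp
  have hj : ∀ k, ∑ j, dz j (dzbar k F) z * X j =
      (1 / 2) * (fderiv ℝ (dzbar k F) z X - Complex.I * fderiv ℝ (dzbar k F) z (Complex.I • X)) :=
    fun k => by
      rw [← sum_mul_wirtinger]
      exact Finset.sum_congr rfl fun j _ => by rw [dz, mul_comm]
  have hk := fun Y => sum_mul_conj_wirtinger (fderiv ℝ (fderiv ℝ F) z Y) X
  have hmain : leviForm f z X X = (1 / 2) *
      ((1 / 2) * (fderiv ℝ (fderiv ℝ F) z X X +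
        Complex.I * fderiv ℝ (fderiv ℝ F) z X (Complex.I • X)) -
      Complex.I * ((1 / 2) * (fderiv ℝ (fderiv ℝ F) z (Complex.I • X) X +
        Complex.I * fderiv ℝ (fderiv ℝ F) z (Complex.I • X) (Complex.I • X)))) := by
    rw [leviForm, Finset.sum_comm]
    simp_rw [← Finset.sum_mul]
    rw [← hk, ← hk, Finset.mul_sum, ← Finset.sum_sub_distrib, Finset.mul_sum]
    refine Finset.sum_congr rfl fun k _ => ?_
    rw [hj, (hdz k).fderiv]
    simp only [smul_apply, add_apply, ContinuousLinearMap.flip_apply, smul_eq_mul]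
    ring
  -- The second derivative of `f` is real, so the mixed terms in `X` and `I • X` are purely
  -- imaginary and drop out of the real part.
  rw [hmain]
  simp only [hB, realLevi]
  simp
  ring

end LeviForm

/-! ### From the sub-mean value inequality to a nonnegative Levi form -/

section Mean

/-- Second order Taylor expansion. -/
theorem eventually_abs_sub_taylor_le {E : Type*} [NormedAddCommGroup E] [NormedSpace ℝ E]
    {h : E → ℝ} (hh : ContDiffAt ℝ 2 h 0) {ε : ℝ} (hε : 0 < ε) :
    ∀ᶠ z in 𝓝 (0 : E), |h z - h 0 - fderiv ℝ h 0 z - (1 / 2) * fderiv ℝ (fderiv ℝ h) 0 z z| ≤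
      ε * ‖z‖ ^ 2 := by
  set B := fderiv ℝ (fderiv ℝ h) 0 with hB
  -- Symmetry makes `2 • B z` the derivative of `B z z`; the mean value inequality then bounds the
  -- Taylor remainder.
  have hsymm : ∀ u v, B u v = B v u := fun u v =>
    (hh.isSymmSndFDerivAt (by simp)).eq u v
  have hd := (differentiableAt_fderiv_of_contDiffAt hh).hasFDerivAt
  have h1 := (hasFDerivAt_iff_isLittleO_nhds_zero.1 hd).def hε
  simp only [zero_add] at h1
  obtain ⟨r, hr, hball⟩ := Metric.eventually_nhds_iff_ball.1
    (h1.and (eventually_differentiableAt_of_contDiffAt hh))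
  have hR : ∀ z ∈ ball (0 : E) r, HasFDerivAt
      (fun z => h z - h 0 - fderiv ℝ h 0 z - (1 / 2) * B z z)
      (fderiv ℝ h z - fderiv ℝ h 0 - B z) z := by
    intro z hz
    have h2 : HasFDerivAt (fun z => B z z) (2 • B z) z := by
      refine (B.hasFDerivAt.clm_apply (hasFDerivAt_id z)).congr_fderiv ?_
      ext u
      simp [hsymm u z, two_mul]
    refine ((((hball z hz).2.hasFDerivAt.sub_const (h 0)).sub
      (fderiv ℝ h 0).hasFDerivAt).sub (h2.const_mul (1 / 2))).congr_fderiv ?_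
    ext u
    simp
  filter_upwards [ball_mem_nhds (0 : E) hr] with z hz
  have hsub : closedBall (0 : E) ‖z‖ ⊆ ball 0 r :=
    closedBall_subset_ball (mem_ball_zero_iff.1 hz)
  have := (convex_closedBall (0 : E) ‖z‖).norm_image_sub_le_of_norm_hasFDerivWithin_le
    (C := ε * ‖z‖) (fun w hw => (hR w (hsub hw)).hasFDerivWithinAt) (fun w hw => ?_)
    (x := 0) (y := z) (by simp) (by simp)
  · simpa [mul_assoc, sq] using this
  · refine ((hball w (hsub hw)).1).trans ?_
    exact mul_le_mul_of_nonneg_left (mem_closedBall_zero_iff.1 hw) hε.le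

theorem circleAverage_comp_I_mul (f : ℂ → ℝ) (r : ℝ) :
    Real.circleAverage (fun z => f (Complex.I * z)) 0 r = Real.circleAverage f 0 r := by
  rw [Real.circleAverage_eq_integral_add (f := f) (Real.pi / 2), Real.circleAverage]
  congr 2
  ext θ
  congr 1
  simp only [circleMap, zero_add]
  push_cast
  rw [add_mul, Complex.exp_add, Complex.exp_pi_div_two_mul_I]
  ring

/-- Averaging the second order Taylor polynomial over the circle of radius `r` leaves `h 0 +
realLevi h 0 1 * r² / 4`. -/
theorem realLevi_nonneg_of_le_circleAverage {h : ℂ → ℝ} (hh : ContDiffAt ℝ 2 h 0)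
    (hm : ∀ᶠ r in 𝓝[>] (0 : ℝ), CircleIntegrable h 0 r ∧ h 0 ≤ Real.circleAverage h 0 r) :
    0 ≤ realLevi h 0 1 := by
  by_contra! hneg
  -- With this `ε` the Taylor error `ε r²` is half of the deficit `-realLevi h 0 1 * r² / 4`, so the
  -- average would drop below `h 0`.
  set ε := -realLevi h 0 1 / 8 with hεdef
  have hε : 0 < ε := by rw [hεdef]; linarith
  set B := fderiv ℝ (fderiv ℝ h) 0 with hB
  set q : ℂ → ℝ := fun z => fderiv ℝ h 0 z + (1 / 2) * B z z with hq
  have hqc : Continuous q := by fun_prop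
  -- Summing over the four quarter turns kills the linear part and turns the quadratic part into its
  -- trace.
  have hqsum : ∀ z, q z + q (Complex.I * z) + q (Complex.I * (Complex.I * z)) +
      q (Complex.I * (Complex.I * (Complex.I * z))) = realLevi h 0 1 * ‖z‖ ^ 2 := by
    intro z
    have e1 : Complex.I * (Complex.I * z) = -z := by rw [← mul_assoc]; simp
    rw [e1, mul_neg]
    have hz : z = z.re • (1 : ℂ) + z.im • Complex.I := by simp [Complex.re_add_im]
    have hz' : Complex.I * z = (-z.im) • (1 : ℂ) + z.re • Complex.I := by
      apply Complex.ext <;> simp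
    have h2 : B z z + B (Complex.I * z) (Complex.I * z) = realLevi h 0 1 * ‖z‖ ^ 2 := by
      rw [hz', ← Complex.normSq_eq_norm_sq, Complex.normSq_apply]
      conv_lhs => rw [hz]
      simp only [map_add, map_smul, add_apply, smul_apply, smul_eq_mul, realLevi, mul_one]
      simp
      ring
    rw [← h2]
    simp only [hq, map_neg, neg_apply]
    ring
  obtain ⟨ρ, hρ, hball⟩ := Metric.eventually_nhds_iff_ball.1 (eventually_abs_sub_taylor_le hh hε)
  obtain ⟨r, ⟨hint, hr⟩, hr0, hrρ⟩ := (hm.and (Ioo_mem_nhdsGT hρ)).exists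
  have hq4 : Real.circleAverage q 0 r = realLevi h 0 1 * r ^ 2 / 4 := by
    have hci : ∀ {f : ℂ → ℝ}, Continuous f → CircleIntegrable f 0 r := fun hf =>
      hf.continuousOn.circleIntegrable'
    have h1 := circleAverage_comp_I_mul q r
    have h2 := circleAverage_comp_I_mul (fun z => q (Complex.I * z)) r
    have h3 := circleAverage_comp_I_mul (fun z => q (Complex.I * (Complex.I * z))) r
    have h4 : Real.circleAverage (fun z => q z + q (Complex.I * z) +
        q (Complex.I * (Complex.I * z)) + q (Complex.I * (Complex.I * (Complex.I * z)))) 0 r =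
        realLevi h 0 1 * r ^ 2 := by
      rw [funext hqsum]
      refine Real.circleAverage_const_on_circle fun z hz => ?_
      rw [mem_sphere_zero_iff_norm.1 hz, sq_abs]
    rw [Real.circleAverage_fun_add (hci (by fun_prop)) (hci (by fun_prop)),
      Real.circleAverage_fun_add (hci (by fun_prop)) (hci (by fun_prop)),
      Real.circleAverage_fun_add (hci (by fun_prop)) (hci (by fun_prop))] at h4
    linarith
  have hle : Real.circleAverage h 0 r ≤ Real.circleAverage (fun z => q z + (h 0 + ε * r ^ 2)) 0 r := by
    refine Real.circleAverage_mono hint (Continuous.continuousOn (by fun_prop)).circleIntegrable'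
      fun z hz => ?_
    rw [mem_sphere_zero_iff_norm, abs_of_pos hr0] at hz
    have := (abs_le.1 (hball z (by rw [mem_ball_zero_iff, hz]; exact hrρ))).2
    rw [hz] at this
    simp only [hq]
    linarith
  rw [Real.circleAverage_fun_add hqc.continuousOn.circleIntegrable'
    continuousOn_const.circleIntegrable', Real.circleAverage_const, hq4] at hle
  have : 0 < r ^ 2 := by positivity
  nlinarith

/-- The restriction of `φ` to the complex line through `z` in direction `X` satisfies the sub-mean
value inequality on all small circles. -/
theorem PlurisubharmonicOn.realLevi_nonneg {m : ℕ} {φ : Cn m → ℝ} {Ω : Set (Cn m)}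
    (hφ : PlurisubharmonicOn φ Ω) (hΩ : IsOpen Ω) (hC : ContDiffOn ℝ 2 φ Ω) {z : Cn m}
    (hz : z ∈ Ω) (X : Cn m) : 0 ≤ realLevi φ z X := by
  have hg : AnalyticAt ℂ (fun ζ : ℂ => z + ζ • X) 0 := by fun_prop
  have hφz : ContDiffAt ℝ 2 φ z := hC.contDiffAt (hΩ.mem_nhds hz)
  have hφ0 : ContDiffAt ℝ 2 φ (z + (0 : ℂ) • X) := by simpa using hφz
  have hd : deriv (fun ζ : ℂ => z + ζ • X) 0 = X := by
    simpa using (((hasDerivAt_id (0 : ℂ)).smul_const X).const_add z).deriv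
  have h1 := realLevi_comp_analyticAt hφ0 hg
  rw [hd, zero_smul, add_zero] at h1
  rw [← h1]
  refine realLevi_nonneg_of_le_circleAverage
    (hφ0.comp (0 : ℂ) (hg.contDiffAt.restrict_scalars ℝ)) ?_
  have hcont : Tendsto (fun ζ : ℂ => z + ζ • X) (𝓝 0) (𝓝 z) := by
    simpa using hg.continuousAt.tendsto
  obtain ⟨ρ, hρ, hball⟩ := Metric.eventually_nhds_iff_ball.1 (hcont.eventually (hΩ.mem_nhds hz))
  filter_upwards [Ioo_mem_nhdsGT hρ] with r hr
  obtain ⟨h2, h3⟩ := hφ.2 z ((r : ℂ) • X) fun ζ hζ => by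
    rw [smul_smul]
    refine hball _ ?_
    rw [mem_ball_zero_iff, norm_mul, Complex.norm_real, Real.norm_of_nonneg hr.1.le]
    nlinarith [hr.1, hr.2]
  have hmap : ∀ θ, z + circleMap 0 1 θ • (r : ℂ) • X = z + circleMap 0 r θ • X := fun θ => by
    rw [smul_smul]; simp [circleMap, mul_comm]
  refine ⟨?_, ?_⟩
  · simpa only [CircleIntegrable, hmap] using h2
  · simpa only [Real.circleAverage, hmap, zero_smul, add_zero] using h3

end Mean

/-! ### The glued function with a pole of its logarithm at `w₀` -/

/-- The radial profile `t e^{-128 t}` near `0`, glued by a maximum to the constant `1 / 512`. -/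
noncomputable def glueProfile (t : ℝ) : ℝ :=
  if t ≤ 1 / 128 then t * Real.exp (-128 * t) else max (t * Real.exp (-128 * t)) (1 / 512)

/-- At the junction `t = 1/128` the profile `t e^{-128 t}` equals `e⁻¹ / 128`, which exceeds `1/512`
because `e < 4`; the maximum there is the inner branch. -/
theorem continuous_glueProfile : Continuous glueProfile := by
  refine Continuous.if_le (by fun_prop) (by fun_prop) continuous_id continuous_const ?_
  rintro t rfl
  rw [max_eq_left]
  have h1 : Real.exp (-128 * (1 / 128)) = (Real.exp 1)⁻¹ := by rw [← Real.exp_neg]; norm_num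
  rw [h1]
  have h2 : (4 : ℝ)⁻¹ ≤ (Real.exp 1)⁻¹ :=
    inv_anti₀ (Real.exp_pos 1) (by linarith [Real.exp_one_lt_d9])
  linarith

theorem mul_exp_le_glueProfile (t : ℝ) : t * Real.exp (-128 * t) ≤ glueProfile t := by
  unfold glueProfile
  split_ifs
  · exact le_rfl
  · exact le_max_left _ _

theorem glueProfile_of_le {t : ℝ} (ht : t ≤ 1 / 128) :
    glueProfile t = t * Real.exp (-128 * t) := if_pos ht

theorem le_glueProfile_of_lt {t : ℝ} (ht : 1 / 128 < t) : 1 / 512 ≤ glueProfile t := by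
  rw [glueProfile, if_neg ht.not_ge]
  exact le_max_right _ _

theorem glueProfile_eq_or {t : ℝ} (ht : 1 / 128 < t) :
    glueProfile t = t * Real.exp (-128 * t) ∨ glueProfile t = 1 / 512 := by
  rw [glueProfile, if_neg ht.not_ge]
  exact max_choice _ _

/-- The threshold comes from `e^x ≥ 1 + x + x²/2` at `x = 128 t`: the quadratic term `8192 t²`
dominates `512 t` once `t ≥ 1/16`, that is, at distance `1/4` from `w₀`. -/
theorem glueProfile_of_ge {t : ℝ} (ht : 1 / 16 ≤ t) : glueProfile t = 1 / 512 := by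
  rw [glueProfile, if_neg (by linarith), max_eq_right]
  have h1 := Real.quadratic_le_exp_of_nonneg (x := 128 * t) (by linarith)
  rw [show -128 * t = -(128 * t) by ring, Real.exp_neg, ← div_eq_mul_inv,
    div_le_iff₀ (Real.exp_pos _)]
  nlinarith

theorem glueProfile_nonneg {t : ℝ} (ht : 0 ≤ t) : 0 ≤ glueProfile t :=
  (mul_nonneg ht (Real.exp_pos _).le).trans (mul_exp_le_glueProfile t)

theorem glueProfile_le_one {t : ℝ} (ht : 0 ≤ t) : glueProfile t ≤ 1 := by
  have h : t * Real.exp (-128 * t) ≤ 1 := by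
    rw [show -128 * t = -(128 * t) by ring, Real.exp_neg, ← div_eq_mul_inv,
      div_le_one (Real.exp_pos _)]
    linarith [Real.add_one_le_exp (128 * t)]
  unfold glueProfile
  split_ifs
  · exact h
  · exact max_le h (by norm_num)

section Localization

variable {m : ℕ} {Φ : Cn m → Cn m} {φ : Cn m → ℝ} {Ω : Set (Cn m)} {s : ℝ} {w₀ : Cn m}

open Classical in
/-- The function `glueProfile ‖Φ⁻¹ q - w₀‖²`, extended by its constant outer value. -/
noncomputable def glueFun (Φ : Cn m → Cn m) (w₀ q : Cn m) : ℝ :=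
  if q ∈ Φ '' ball 0 1 then glueProfile (‖Function.invFunOn Φ (ball 0 1) q - w₀‖ ^ 2) else 1 / 512

theorem glueFun_apply (hΦ : IsHolomorphicBallEmbedding Φ Ω) {w : Cn m}
    (hw : w ∈ ball (0 : Cn m) 1) : glueFun Φ w₀ (Φ w) = glueProfile (‖w - w₀‖ ^ 2) := by
  rw [glueFun, if_pos (mem_image_of_mem Φ hw), hΦ.invFunOn_apply hw]

theorem glueFun_of_notMem {q : Cn m} (hq : q ∉ Φ '' ball 0 1) : glueFun Φ w₀ q = 1 / 512 :=
  if_neg hq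

theorem glueFun_nonneg (q : Cn m) : 0 ≤ glueFun Φ w₀ q := by
  unfold glueFun
  split_ifs
  · exact glueProfile_nonneg (by positivity)
  · norm_num

theorem glueFun_le_one (q : Cn m) : glueFun Φ w₀ q ≤ 1 := by
  unfold glueFun
  split_ifs
  · exact glueProfile_le_one (by positivity)
  · norm_num

theorem closedBall_subset_of_norm_lt (hw₀ : ‖w₀‖ < 1 / 2) {r : ℝ} (hr : r ≤ 1 / 4) :
    closedBall w₀ r ⊆ closedBall 0 (3 / 4) := by
  intro w hw
  rw [mem_closedBall_iff_norm] at hw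
  rw [mem_closedBall_zero_iff]
  have := norm_add_le (w - w₀) w₀
  rw [sub_add_cancel] at this
  linarith

theorem isCompact_image_closedBall (hΦ : IsHolomorphicBallEmbedding Φ Ω) {w : Cn m} {r : ℝ}
    (h : closedBall w r ⊆ ball 0 1) : IsCompact (Φ '' closedBall w r) :=
  (isCompact_closedBall w r).image_of_continuousOn (hΦ.differentiableOn.continuousOn.mono h)

theorem continuous_glueFun (hΦ : IsHolomorphicBallEmbedding Φ Ω) (hw₀ : ‖w₀‖ < 1 / 2) :
    Continuous (glueFun Φ w₀) := by
  have hsub : closedBall w₀ (1 / 4) ⊆ ball 0 1 :=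
    (closedBall_subset_of_norm_lt hw₀ le_rfl).trans (closedBall_subset_ball (by norm_num))
  rw [continuous_iff_continuousAt]
  intro q
  by_cases hq : q ∈ Φ '' ball 0 1
  · have hopen := (hΦ.isOpen_image isOpen_ball Subset.rfl).mem_nhds hq
    obtain ⟨w, hw, rfl⟩ := hq
    have h1 : ContinuousAt (fun q => glueProfile (‖Function.invFunOn Φ (ball 0 1) q - w₀‖ ^ 2))
        (Φ w) := continuous_glueProfile.continuousAt.comp
      (((hΦ.differentiableAt_invFunOn hw).continuousAt.sub continuousAt_const).norm.pow 2)
    refine h1.congr ?_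
    filter_upwards [hopen] with q hq
    rw [glueFun, if_pos hq]
  -- Away from the compact image of the closed ball of radius `1/4` the function is constant, and
  -- this image is closed in the whole space.
  · have hopen : (Φ '' closedBall w₀ (1 / 4))ᶜ ∈ 𝓝 q :=
      (isCompact_image_closedBall hΦ hsub).isClosed.isOpen_compl.mem_nhds
        fun h => hq (image_mono hsub h)
    refine (continuousAt_const (y := (1 / 512 : ℝ))).congr ?_
    filter_upwards [hopen] with q' hq'
    by_cases hqB : q' ∈ Φ '' ball 0 1
    · obtain ⟨w, hw, rfl⟩ := hqB
      rw [glueFun_apply hΦ hw, glueProfile_of_ge]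
      have h2 : 1 / 4 < ‖w - w₀‖ := by
        by_contra! h
        exact hq' (mem_image_of_mem Φ (mem_closedBall_iff_norm.2 h))
      nlinarith
    · rw [glueFun_of_notMem hqB]

theorem realLevi_log_norm {h : ℂ → ℂ} {ζ : ℂ} (hh : AnalyticAt ℂ h ζ) (h0 : h ζ ≠ 0) :
    ContDiffAt ℝ 2 (fun z => Real.log ‖h z‖) ζ ∧
      realLevi (fun z => Real.log ‖h z‖) ζ 1 = 0 :=
  have := hh.harmonicAt_log_norm h0
  ⟨this.1, realLevi_eq_zero_of_harmonicAt this⟩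

/-- `λ φ ∘ f - log |ζ| + |ζ|²` is strictly subharmonic away from the origin. -/
theorem realLevi_base {f : ℂ → Cn m} {ζ : ℂ} {c : ℝ} (hζ : ζ ≠ 0)
    (hφ : ContDiffAt ℝ 2 (fun z => φ (f z)) ζ) :
    ContDiffAt ℝ 2 (fun z => c * φ (f z) + (-1 * Real.log ‖z‖ + ‖z - 0‖ ^ 2)) ζ ∧
    realLevi (fun z => c * φ (f z) + (-1 * Real.log ‖z‖ + ‖z - 0‖ ^ 2)) ζ 1 =
      c * realLevi (fun z => φ (f z)) ζ 1 + 4 := by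
  obtain ⟨h1, h2⟩ := realLevi_log_norm (h := fun z => z) (ζ := ζ) (by fun_prop) hζ
  have h3 : ContDiffAt ℝ 2 (fun z : ℂ => ‖z - 0‖ ^ 2) ζ := (contDiff_norm_sub_sq 0).contDiffAt
  have h4 : ContDiffAt ℝ 2 (fun z : ℂ => -1 * Real.log ‖z‖) ζ := contDiffAt_const.mul h1
  have h5 : ContDiffAt ℝ 2 (fun z => c * φ (f z)) ζ := contDiffAt_const.mul hφ
  refine ⟨h5.add (h4.add h3), ?_⟩
  rw [realLevi_add h5 (h4.add h3), realLevi_add h4 h3, realLevi_const_mul hφ,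
    realLevi_const_mul h1, h2, realLevi_norm_sub_sq]
  simp

end Localization

/-! ### Maximum principle along holomorphic discs -/

/-- The data attached to a point of a weakly homogeneous regular domain: a ball embedding together
with a bounded plurisubharmonic function whose pullback is uniformly strictly plurisubharmonic. -/
structure IsWHHRChart {m : ℕ} (Ω : Set (Cn m)) (s : ℝ) (Φ : Cn m → Cn m) (φ : Cn m → ℝ) :
    Prop where
  isOpen : IsOpen Ω
  pos : 0 < s
  embedding : IsHolomorphicBallEmbedding Φ Ω
  contDiffOn : ContDiffOn ℝ 2 φ Ω
  psh : PlurisubharmonicOn φ Ω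
  mapsTo : MapsTo φ Ω (Icc 0 1)
  levi : ∀ w ∈ ball (0 : Cn m) 1, ∀ X : Cn m, s ^ 2 * ‖X‖ ^ 2 ≤ (leviForm (φ ∘ Φ) w X X).re

/-- The weight whose product with `glueFun` is logarithmically plurisubharmonic along discs. -/
noncomputable def discWeight {m : ℕ} (φ : Cn m → ℝ) (s : ℝ) (f : ℂ → Cn m) (z : ℂ) : ℝ :=
  128 / s ^ 2 * φ (f z) + (-1 * Real.log ‖z‖ + ‖z - 0‖ ^ 2)

namespace IsWHHRChart

variable {m : ℕ} {Ω : Set (Cn m)} {s : ℝ} {Φ : Cn m → Cn m} {φ : Cn m → ℝ} {w₀ : Cn m}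
  {f : ℂ → Cn m} {ζ : ℂ}

theorem contDiffAt_comp (h : IsWHHRChart Ω s Φ φ) (hf : AnalyticAt ℂ f ζ) (hfΩ : f ζ ∈ Ω) :
    ContDiffAt ℝ 2 (fun z => φ (f z)) ζ :=
  (h.contDiffOn.contDiffAt (h.isOpen.mem_nhds hfΩ)).comp ζ
    (hf.contDiffAt.restrict_scalars ℝ)

/-- Where `glueFun` takes its outer value there is no local maximum. -/
theorem not_isLocalMax_discWeight (h : IsWHHRChart Ω s Φ φ) (hf : AnalyticAt ℂ f ζ)
    (hfΩ : f ζ ∈ Ω) (hζ : ζ ≠ 0) : ¬ IsLocalMax (discWeight φ s f) ζ := by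
  intro hmax
  obtain ⟨h1, h2⟩ := realLevi_base (c := 128 / s ^ 2) hζ (h.contDiffAt_comp hf hfΩ)
  have h3 := realLevi_nonpos_of_isLocalMax h1 hmax
  rw [h2, realLevi_comp_analyticAt (h.contDiffOn.contDiffAt (h.isOpen.mem_nhds hfΩ)) hf] at h3
  have h4 := h.psh.realLevi_nonneg h.isOpen h.contDiffOn hfΩ (deriv f ζ)
  have : 0 ≤ 128 / s ^ 2 := by positivity
  nlinarith [mul_nonneg this h4]

/-- Where `glueFun` takes its inner value there is no local maximum. -/
theorem not_isLocalMax_inner (h : IsWHHRChart Ω s Φ φ) {g : ℂ → Cn m} (hg : AnalyticAt ℂ g ζ)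
    (hgB : g ζ ∈ ball (0 : Cn m) 1) (hfg : f =ᶠ[𝓝 ζ] fun z => Φ (g z)) (hζ : ζ ≠ 0)
    {l : Cn m →L[ℂ] ℂ} (hl : l (g ζ - w₀) ≠ 0) :
    ¬ IsLocalMax (fun z => 2 * Real.log ‖l (g z - w₀)‖ + (-128 * ‖g z - w₀‖ ^ 2
      + discWeight φ s f z)) ζ := by
  intro hmax
  have hΦ := h.embedding
  have hφΦ : ContDiffAt ℝ 2 (fun w => φ (Φ w)) (g ζ) :=
    (h.contDiffOn.contDiffAt (h.isOpen.mem_nhds (hΦ.mapsTo hgB))).comp (g ζ) (hΦ.contDiffAt hgB)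
  have hgC : ContDiffAt ℝ 2 g ζ := hg.contDiffAt.restrict_scalars ℝ
  have hev : (fun z => φ (f z)) =ᶠ[𝓝 ζ] fun z => φ (Φ (g z)) :=
    hfg.mono fun z hz => by simp only [hz]
  have hφf : ContDiffAt ℝ 2 (fun z => φ (f z)) ζ :=
    (hφΦ.comp ζ hgC).congr_of_eventuallyEq hev
  obtain ⟨h1, h2⟩ := realLevi_base (c := 128 / s ^ 2) hζ hφf
  have hlg : AnalyticAt ℂ (fun z => l (g z - w₀)) ζ :=
    (l.analyticAt _).comp (hg.sub analyticAt_const)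
  obtain ⟨h3, h4⟩ := realLevi_log_norm hlg hl
  have h5 : ContDiffAt ℝ 2 (fun w : Cn m => ‖w - w₀‖ ^ 2) (g ζ) :=
    (contDiff_norm_sub_sq w₀).contDiffAt
  have h6 : ContDiffAt ℝ 2 (fun z => ‖g z - w₀‖ ^ 2) ζ := h5.comp ζ hgC
  have h3' : ContDiffAt ℝ 2 (fun z => 2 * Real.log ‖l (g z - w₀)‖) ζ := contDiffAt_const.mul h3
  have h6' : ContDiffAt ℝ 2 (fun z => -128 * ‖g z - w₀‖ ^ 2) ζ := contDiffAt_const.mul h6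
  have h1' : ContDiffAt ℝ 2 (discWeight φ s f) ζ := h1
  have h2' : realLevi (discWeight φ s f) ζ 1 = _ := h2
  have h7 := realLevi_nonpos_of_isLocalMax (h3'.add (h6'.add h1')) hmax
  rw [realLevi_add h3' (h6'.add h1'), realLevi_add h6' h1', realLevi_const_mul h3,
    realLevi_const_mul h6, h4, h2', realLevi_comp_analyticAt h5 hg, realLevi_norm_sub_sq,
    realLevi_congr hev, realLevi_comp_analyticAt hφΦ hg] at h7
  have h8 := h.levi (g ζ) hgB (deriv g ζ)
  rw [re_leviForm_self (f := φ ∘ Φ) hφΦ] at h8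
  have hs := h.pos
  -- The factor `128 / s²` is chosen here: four times this bound cancels the contribution `-512
  -- ‖g'‖²` of `-128 ‖g - w₀‖²`, leaving the `4` from `|ζ|²`.
  have h9 : 128 / s ^ 2 * (s ^ 2 * ‖deriv g ζ‖ ^ 2) = 128 * ‖deriv g ζ‖ ^ 2 := by
    field_simp
  have h10 := mul_le_mul_of_nonneg_left h8 (show 0 ≤ 128 / s ^ 2 by positivity)
  rw [h9] at h10
  change _ ≤ 128 / s ^ 2 * (realLevi (fun w => φ (Φ w)) (g ζ) (deriv g ζ) / 4) at h10
  linarith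

/-- The function `glueFun · exp discWeight` has no positive local maximum on the punctured disc. -/
theorem not_isLocalMax_glueFun (h : IsWHHRChart Ω s Φ φ) (hw₀ : ‖w₀‖ < 1 / 2)
    (hf : AnalyticAt ℂ f ζ) (hfΩ : f ζ ∈ Ω) (hζ : ζ ≠ 0) (hpos : 0 < glueFun Φ w₀ (f ζ)) :
    ¬ IsLocalMax (fun z => glueFun Φ w₀ (f z) * Real.exp (discWeight φ s f z)) ζ := by
  intro hmax
  have hΦ := h.embedding
  -- If `glueFun` is `1/512` at `ζ` and no smaller nearby, a local maximum of the product is one of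
  -- the weight alone.
  have outer : glueFun Φ w₀ (f ζ) = 1 / 512 → (∀ᶠ z in 𝓝 ζ, 1 / 512 ≤ glueFun Φ w₀ (f z)) →
      False := by
    intro h1 h2
    refine h.not_isLocalMax_discWeight hf hfΩ hζ ?_
    filter_upwards [hmax, h2] with z h3 h4
    rw [h1] at h3
    have h5 : Real.exp (discWeight φ s f z) ≤ Real.exp (discWeight φ s f ζ) := by
      nlinarith [Real.exp_pos (discWeight φ s f z)]
    exact Real.exp_le_exp.1 h5
  by_cases hB : f ζ ∈ Φ '' ball 0 1
  · have hopen := (hΦ.isOpen_image isOpen_ball Subset.rfl).mem_nhds hB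
    obtain ⟨w, hw, hwf⟩ := hB
    set g : ℂ → Cn m := fun z => Function.invFunOn Φ (ball 0 1) (f z) with hgdef
    have hgζ : g ζ = w := by
      simp only [hgdef]
      rw [← hwf, hΦ.invFunOn_apply hw]
    have hfev : ∀ᶠ z in 𝓝 ζ, f z ∈ Φ '' ball 0 1 := hf.continuousAt.eventually hopen
    have hgB : ∀ z, f z ∈ Φ '' ball 0 1 → g z ∈ ball (0 : Cn m) 1 ∧ Φ (g z) = f z :=
      fun z hz => ⟨Function.invFunOn_mem hz, Function.invFunOn_eq hz⟩
    have hga : AnalyticAt ℂ g ζ := by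
      rw [Complex.analyticAt_iff_eventually_differentiableAt]
      filter_upwards [hfev, hf.eventually_analyticAt] with z hz hz'
      obtain ⟨w', hw', hwz⟩ := hz
      have h1 := hΦ.differentiableAt_invFunOn hw'
      rw [hwz] at h1
      exact h1.comp z hz'.differentiableAt
    have hglue : ∀ z, f z ∈ Φ '' ball 0 1 →
        glueFun Φ w₀ (f z) = glueProfile (‖g z - w₀‖ ^ 2) := fun z hz => if_pos hz
    have hζB : f ζ ∈ Φ '' ball 0 1 := hfev.self_of_nhds
    have inner : glueFun Φ w₀ (f ζ) = ‖g ζ - w₀‖ ^ 2 * Real.exp (-128 * ‖g ζ - w₀‖ ^ 2) →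
        False := by
      intro h1
      have hne : g ζ - w₀ ≠ 0 := by
        intro h0
        rw [h1, h0] at hpos
        simp at hpos
      -- A norming functional gives `log |l (g - w₀)|`, a harmonic minorant of `log ‖g - w₀‖` with
      -- equality at `ζ`. The maximum passes to the minorant, which can be differentiated.
      obtain ⟨l, hl1, hl2⟩ := exists_dual_vector ℂ (g ζ - w₀) (norm_ne_zero_iff.2 hne)
      have hnorm : 0 < ‖g ζ - w₀‖ := norm_pos_iff.2 hne
      have hlζ : ‖l (g ζ - w₀)‖ = ‖g ζ - w₀‖ := by rw [hl2]; simp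
      have hl0 : l (g ζ - w₀) ≠ 0 := by rw [← norm_pos_iff, hlζ]; exact hnorm
      refine h.not_isLocalMax_inner (w₀ := w₀) hga (hgB ζ hζB).1
        (hfev.mono fun z hz => (hgB z hz).2.symm) hζ hl0 ?_
      have hlev : ∀ᶠ z in 𝓝 ζ, l (g z - w₀) ≠ 0 :=
        (l.continuous.continuousAt.comp
          (hga.continuousAt.sub continuousAt_const)).eventually_ne hl0
      have hexp : ∀ a b c : ℝ, 0 < a → Real.exp (2 * Real.log a + (b + c)) =
          a ^ 2 * Real.exp b * Real.exp c := by
        intro a b c ha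
        rw [Real.exp_add, Real.exp_add, two_mul, Real.exp_add, Real.exp_log ha]
        ring
      filter_upwards [hmax, hfev, hlev] with z h2 h3 h4
      rw [← Real.exp_le_exp, hexp _ _ _ (norm_pos_iff.2 h4), hexp _ _ _ (norm_pos_iff.2 hl0),
        hlζ, ← h1]
      refine le_trans ?_ h2
      refine mul_le_mul_of_nonneg_right ?_ (Real.exp_pos _).le
      rw [hglue z h3]
      refine le_trans ?_ (mul_exp_le_glueProfile _)
      refine mul_le_mul_of_nonneg_right ?_ (Real.exp_pos _).le
      have h5 := l.le_opNorm (g z - w₀)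
      rw [hl1, one_mul] at h5
      exact pow_le_pow_left₀ (norm_nonneg _) h5 2
    rcases le_or_gt (‖g ζ - w₀‖ ^ 2) (1 / 128) with hle | hlt
    · exact inner (by rw [hglue ζ hζB, glueProfile_of_le hle])
    · rcases glueProfile_eq_or hlt with h1 | h1
      · exact inner (by rw [hglue ζ hζB, h1])
      · refine outer (by rw [hglue ζ hζB, h1]) ?_
        have hcont : ContinuousAt (fun z => ‖g z - w₀‖ ^ 2) ζ :=
          (hga.continuousAt.sub continuousAt_const).norm.pow 2
        filter_upwards [hcont.eventually (lt_mem_nhds hlt), hfev] with z h2 h3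
        rw [hglue z h3]
        exact le_glueProfile_of_lt h2
  · refine outer (glueFun_of_notMem hB) ?_
    have hsub : closedBall w₀ (1 / 4) ⊆ ball 0 1 :=
      (closedBall_subset_of_norm_lt hw₀ le_rfl).trans (closedBall_subset_ball (by norm_num))
    have hopen : (Φ '' closedBall w₀ (1 / 4))ᶜ ∈ 𝓝 (f ζ) :=
      (isCompact_image_closedBall hΦ hsub).isClosed.isOpen_compl.mem_nhds
        fun h => hB (image_mono hsub h)
    filter_upwards [hf.continuousAt.eventually hopen] with z hz
    by_cases hqB : f z ∈ Φ '' ball 0 1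
    · obtain ⟨w, hw, hwz⟩ := hqB
      rw [← hwz, glueFun_apply hΦ hw]
      refine le_glueProfile_of_lt ?_
      have h2 : 1 / 4 < ‖w - w₀‖ := by
        by_contra! h
        exact hz (hwz ▸ mem_image_of_mem Φ (mem_closedBall_iff_norm.2 h))
      nlinarith
    · rw [glueFun_of_notMem hqB]

/-- The bound for `glueFun` along a holomorphic disc centred at its pole. -/
theorem glueFun_le (h : IsWHHRChart Ω s Φ φ) (hw₀ : ‖w₀‖ < 1 / 2)
    (hf : DifferentiableOn ℂ f (ball 0 1)) (hfΩ : MapsTo f (ball 0 1) Ω) (hf0 : f 0 = Φ w₀)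
    (hζ : ‖ζ‖ ≤ 1 / 2) : glueFun Φ w₀ (f ζ) ≤ 2 * Real.exp (128 / s ^ 2 + 1) * ‖ζ‖ := by
  have hΦ := h.embedding
  have hw₀B : w₀ ∈ ball (0 : Cn m) 1 := by rw [mem_ball_zero_iff]; linarith
  have hfa : ∀ z ∈ ball (0 : ℂ) 1, AnalyticAt ℂ f z := fun z hz =>
    hf.analyticAt (isOpen_ball.mem_nhds hz)
  set a : ℝ := 128 / s ^ 2 with ha
  have ha0 : 0 ≤ a := by positivity
  set W : ℂ → ℝ := fun z => Real.exp (a * φ (f z) + ‖z‖ ^ 2) with hW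
  -- Division by zero gives `V 0 = 0`, which is the correct limit: `glueFun (f z)` is `O(|z|²)` near
  -- the origin.
  set V : ℂ → ℝ := fun z => glueFun Φ w₀ (f z) * W z / ‖z‖ with hV
  have hVeq : ∀ z, z ≠ 0 → V z = glueFun Φ w₀ (f z) * Real.exp (discWeight φ s f z) := by
    intro z hz
    have h1 : 0 < ‖z‖ := norm_pos_iff.2 hz
    rw [hV, discWeight, sub_zero]
    simp only [hW]
    rw [show 128 / s ^ 2 * φ (f z) + (-1 * Real.log ‖z‖ + ‖z‖ ^ 2) =
      a * φ (f z) + ‖z‖ ^ 2 - Real.log ‖z‖ by rw [ha]; ring, Real.exp_sub, Real.exp_log h1,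
      mul_div_assoc]
  have hV0 : V 0 = 0 := by simp [hV]
  have hVnonneg : ∀ z, 0 ≤ V z := fun z =>
    div_nonneg (mul_nonneg (glueFun_nonneg _) (Real.exp_pos _).le) (norm_nonneg _)
  have hφ01 : ∀ z ∈ ball (0 : ℂ) 1, φ (f z) ∈ Icc (0 : ℝ) 1 := fun z hz => h.mapsTo (hfΩ hz)
  have hWle : ∀ z ∈ ball (0 : ℂ) 1, W z ≤ Real.exp (a + 1) := by
    intro z hz
    refine Real.exp_le_exp.2 ?_
    have h1 := (hφ01 z hz).2
    have h2 := mem_ball_zero_iff.1 hz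
    nlinarith [norm_nonneg z]
  have hball : closedBall (0 : ℂ) (1 / 2) ⊆ ball 0 1 := closedBall_subset_ball (by norm_num)
  have hcont : ContinuousOn V (closedBall 0 (1 / 2)) := by
    intro z hz
    refine ContinuousAt.continuousWithinAt ?_
    have hzB := hball hz
    have hM : ContinuousAt (fun z => glueFun Φ w₀ (f z)) z :=
      (continuous_glueFun hΦ hw₀).continuousAt.comp (hfa z hzB).continuousAt
    by_cases hz0 : z = 0
    · subst hz0
      have hg : DifferentiableAt ℂ (fun z => Function.invFunOn Φ (ball 0 1) (f z)) 0 := by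
        have h1 := hΦ.differentiableAt_invFunOn hw₀B
        rw [← hf0] at h1
        exact h1.comp 0 (hfa 0 hzB).differentiableAt
      have hO := hg.isBigO_sub
      simp only [hf0, hΦ.invFunOn_apply hw₀B, sub_zero] at hO
      obtain ⟨C, hC⟩ := hO.bound
      -- Within distance `1/16` the squared distance is at most `1/256 < 1/128`, so the inner branch
      -- of the profile applies.
      have hfev : ∀ᶠ z in 𝓝 (0 : ℂ), f z ∈ Φ '' closedBall w₀ (1 / 16) := by
        have h2 : Φ '' ball w₀ (1 / 16) ∈ 𝓝 (f 0) := by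
          rw [hf0]
          refine (hΦ.isOpen_image isOpen_ball ?_).mem_nhds
            (mem_image_of_mem Φ (mem_ball_self (by norm_num)))
          exact (ball_subset_closedBall.trans (closedBall_subset_of_norm_lt hw₀
            (by norm_num))).trans (closedBall_subset_ball (by norm_num))
        filter_upwards [(hfa 0 hzB).continuousAt.eventually h2] with z hz
          using image_mono ball_subset_closedBall hz
      have hbound : ∀ᶠ z in 𝓝 (0 : ℂ), V z ≤ C ^ 2 * Real.exp (a + 1) * ‖z‖ := by
        filter_upwards [hC, hfev, ball_mem_nhds (0 : ℂ) one_pos] with z h1 h2 h3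
        obtain ⟨w, hw, hwz⟩ := h2
        have hwB : w ∈ ball (0 : Cn m) 1 :=
          closedBall_subset_ball (by norm_num)
            (closedBall_subset_of_norm_lt hw₀ (by norm_num) hw)
        rw [← hwz, hΦ.invFunOn_apply hwB] at h1
        have hw' := mem_closedBall_iff_norm.1 hw
        have h4 : glueFun Φ w₀ (f z) ≤ ‖w - w₀‖ ^ 2 := by
          rw [← hwz, glueFun_apply hΦ hwB, glueProfile_of_le (by nlinarith [norm_nonneg (w - w₀)])]
          refine mul_le_of_le_one_right (by positivity) (Real.exp_le_one_iff.2 ?_)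
          nlinarith [sq_nonneg ‖w - w₀‖]
        rcases eq_or_ne z 0 with rfl | hz0
        · simp [hV0]
        have h5 : 0 < ‖z‖ := norm_pos_iff.2 hz0
        rw [hV]
        simp only
        rw [div_le_iff₀ h5]
        have h6 : glueFun Φ w₀ (f z) ≤ (C * ‖z‖) ^ 2 :=
          h4.trans (pow_le_pow_left₀ (norm_nonneg _) h1 2)
        calc glueFun Φ w₀ (f z) * W z ≤ (C * ‖z‖) ^ 2 * Real.exp (a + 1) :=
              mul_le_mul h6 (hWle z h3) (Real.exp_pos _).le (by positivity)
          _ = _ := by ring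
      rw [ContinuousAt, hV0]
      refine tendsto_of_tendsto_of_tendsto_of_le_of_le' tendsto_const_nhds ?_
        (Eventually.of_forall hVnonneg) hbound
      have : Tendsto (fun z : ℂ => C ^ 2 * Real.exp (a + 1) * ‖z‖) (𝓝 0)
          (𝓝 (C ^ 2 * Real.exp (a + 1) * ‖(0 : ℂ)‖)) := Continuous.tendsto (by fun_prop) 0
      simpa using this
    · have hφc : ContinuousAt (fun z => φ (f z)) z :=
        (h.contDiffAt_comp (hfa z hzB) (hfΩ hzB)).continuousAt
      refine (hM.mul ?_).div continuous_norm.continuousAt (norm_ne_zero_iff.2 hz0)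
      exact Real.continuous_exp.continuousAt.comp
        ((continuousAt_const.mul hφc).add (continuous_norm.continuousAt.pow 2))
  have hVle : ∀ z ∈ closedBall (0 : ℂ) (1 / 2), V z ≤ 2 * Real.exp (a + 1) := by
    obtain ⟨z₀, hz₀, hmax⟩ := (isCompact_closedBall (0 : ℂ) (1 / 2)).exists_isMaxOn
      ⟨0, mem_closedBall_self (by norm_num)⟩ hcont
    intro z hz
    by_contra! hlt
    have hlt₀ : 2 * Real.exp (a + 1) < V z₀ := hlt.trans_le (hmax hz)
    have hexp := Real.exp_pos (a + 1)
    have hz₀0 : z₀ ≠ 0 := by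
      rintro rfl
      rw [hV0] at hlt₀
      linarith
    have hz₀pos : 0 < ‖z₀‖ := norm_pos_iff.2 hz₀0
    -- On `|z| = 1/2` the bound `2 exp (a + 1)` holds because `glueFun ≤ 1`; a larger maximum must
    -- be interior.
    have hz₀lt : ‖z₀‖ < 1 / 2 := by
      by_contra! hge
      have h1 : V z₀ ≤ 2 * Real.exp (a + 1) := by
        rw [hV]
        simp only
        rw [div_le_iff₀ hz₀pos]
        calc glueFun Φ w₀ (f z₀) * W z₀ ≤ 1 * Real.exp (a + 1) :=
              mul_le_mul (glueFun_le_one _) (hWle z₀ (hball hz₀)) (Real.exp_pos _).le zero_le_one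
          _ ≤ _ := by nlinarith
      linarith
    have hgpos : 0 < glueFun Φ w₀ (f z₀) := by
      refine lt_of_le_of_ne (glueFun_nonneg _) fun h0 => ?_
      rw [hV] at hlt₀
      simp only [← h0, zero_mul, zero_div] at hlt₀
      linarith
    refine h.not_isLocalMax_glueFun hw₀ (hfa z₀ (hball hz₀)) (hfΩ (hball hz₀)) hz₀0 hgpos ?_
    filter_upwards [(isOpen_ball (x := (0 : ℂ)) (ε := 1 / 2)).mem_nhds
      (mem_ball_zero_iff.2 hz₀lt), isOpen_ne.mem_nhds hz₀0] with y hy hy0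
    rw [← hVeq y hy0, ← hVeq z₀ hz₀0]
    exact hmax (ball_subset_closedBall hy)
  rcases eq_or_ne ζ 0 with rfl | hζ0
  · rw [hf0, glueFun_apply hΦ hw₀B, glueProfile_of_le (by simp)]
    simp
  have h1 := hVle ζ (mem_closedBall_zero_iff.2 hζ)
  have h2 : 0 < ‖ζ‖ := norm_pos_iff.2 hζ0
  rw [hV] at h1
  simp only at h1
  rw [div_le_iff₀ h2] at h1
  -- The weight `W` is at least `1`, since `φ ≥ 0`.
  refine le_trans (le_mul_of_one_le_right (glueFun_nonneg _) ?_) h1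
  refine Real.one_le_exp ?_
  have := (hφ01 ζ (hball (mem_closedBall_zero_iff.2 hζ))).1
  positivity

/-- Holomorphic discs centred in `Φ(B(1/2))` stay in `Φ(B(3/4))` for a definite time. -/
theorem mem_image_closedBall (h : IsWHHRChart Ω s Φ φ)
    (hf : DifferentiableOn ℂ f (ball 0 1)) (hfΩ : MapsTo f (ball 0 1) Ω)
    (hf0 : f 0 ∈ Φ '' ball 0 (1 / 2))
    (hζ : ‖ζ‖ < 1 / (1024 * Real.exp (128 / s ^ 2 + 1))) : f ζ ∈ Φ '' closedBall 0 (3 / 4) := by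
  obtain ⟨w₀, hw₀, hw₀f⟩ := hf0
  rw [mem_ball_zero_iff] at hw₀
  have hexp : 1 ≤ Real.exp (128 / s ^ 2 + 1) := Real.one_le_exp (by positivity)
  have hζ2 : ‖ζ‖ ≤ 1 / 2 := by
    refine hζ.le.trans ?_
    rw [div_le_div_iff₀ (by positivity) (by norm_num)]
    linarith
  have h1 := h.glueFun_le hw₀ hf hfΩ hw₀f.symm hζ2
  rw [lt_div_iff₀ (by positivity)] at hζ
  -- Below the outer value `1/512` the point must lie in the chart, with squared distance at most
  -- `1/128 < 1/16` from `w₀`.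
  have h2 : glueFun Φ w₀ (f ζ) < 1 / 512 := by linarith
  by_cases hB : f ζ ∈ Φ '' ball 0 1
  · obtain ⟨w, hw, hwf⟩ := hB
    rw [← hwf, glueFun_apply h.embedding hw] at h2
    have h3 : ‖w - w₀‖ ^ 2 ≤ 1 / 128 := by
      by_contra! hlt
      linarith [le_glueProfile_of_lt hlt]
    refine ⟨w, closedBall_subset_of_norm_lt hw₀ le_rfl (mem_closedBall_iff_norm.2 ?_), hwf⟩
    nlinarith [norm_nonneg (w - w₀)]
  · rw [glueFun_of_notMem hB] at h2
    exact absurd h2 (lt_irrefl _)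

end IsWHHRChart

/-! ### Uniform localization and its propagation -/

/-- **Uniform localization**: holomorphic discs in a weakly homogeneous regular domain that start
in a given compact set stay in a larger compact set on a disc whose radius does not depend on the
compact set. -/
theorem IsWHHRDomain.exists_localization {m : ℕ} {Ω : Set (Cn m)} (h : IsWHHRDomain Ω) :
    ∃ c : ℝ, 0 < c ∧ ∀ L : Set (Cn m), IsCompact L → L ⊆ Ω → ∃ L' : Set (Cn m), IsCompact L' ∧
      L' ⊆ Ω ∧ ∀ f : ℂ → Cn m, DifferentiableOn ℂ f (ball 0 1) → MapsTo f (ball 0 1) Ω →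
        f 0 ∈ L → ∀ ζ : ℂ, ‖ζ‖ < c → f ζ ∈ L' := by
  obtain ⟨s, hs, hchart⟩ := h.exists_bound
  choose! Φ φ hΦ hΦ0 hC hpsh h01 hlevi using hchart
  have hch : ∀ p ∈ Ω, IsWHHRChart Ω s (Φ p) (φ p) := fun p hp =>
    ⟨h.isOpen, hs, hΦ p hp, hC p hp, hpsh p hp, h01 p hp, hlevi p hp⟩
  -- The radius involves only `s`, which is common to all charts.
  refine ⟨1 / (1024 * Real.exp (128 / s ^ 2 + 1)), by positivity, fun L hL hLΩ => ?_⟩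
  obtain ⟨t, htL, hcover⟩ := hL.elim_nhds_subcover (fun p => Φ p '' ball 0 (1 / 2)) fun p hp => by
    have h1 := ((hΦ p (hLΩ hp)).isOpen_image (isOpen_ball (x := (0 : Cn m)) (ε := 1 / 2))
      (ball_subset_ball (by norm_num))).mem_nhds
        (mem_image_of_mem _ (mem_ball_self (by norm_num)))
    rwa [hΦ0 p (hLΩ hp)] at h1
  have hsub : closedBall (0 : Cn m) (3 / 4) ⊆ ball 0 1 := closedBall_subset_ball (by norm_num)
  refine ⟨⋃ p ∈ t, Φ p '' closedBall 0 (3 / 4), ?_, ?_, ?_⟩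
  · exact t.isCompact_biUnion fun p hp =>
      isCompact_image_closedBall (hΦ p (hLΩ (htL p hp))) hsub
  · refine iUnion₂_subset fun p hp => ?_
    exact ((hΦ p (hLΩ (htL p hp))).mapsTo.mono_left hsub).image_subset
  · intro f hf hfΩ hf0 ζ hζ
    obtain ⟨p, hp, hpf⟩ := mem_iUnion₂.1 (hcover hf0)
    exact mem_iUnion₂.2 ⟨p, hp,
      (hch p (hLΩ (htL p hp))).mem_image_closedBall hf hfΩ hpf hζ⟩

/-- Compact subsets of `Ω` are mapped to compact subsets of `Ω` by short holomorphic discs: the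
conclusion of the localization theorem, with radius `c`. -/
def HasLocalization {m : ℕ} (Ω : Set (Cn m)) (c : ℝ) : Prop :=
  ∀ L : Set (Cn m), IsCompact L → L ⊆ Ω → ∃ L' : Set (Cn m), IsCompact L' ∧
    L' ⊆ Ω ∧ ∀ f : ℂ → Cn m, DifferentiableOn ℂ f (ball 0 1) → MapsTo f (ball 0 1) Ω →
      f 0 ∈ L → ∀ ζ : ℂ, ‖ζ‖ < c → f ζ ∈ L'

/-- The family `f` of maps `N → Ω` is locally controlled: near each point, a bound by a compact
subset of `Ω` at one point gives such a bound at all points. -/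
def LocallyControlled {N : Type*} [TopologicalSpace N] {m : ℕ} (Ω : Set (Cn m))
    (f : ℕ → N → Cn m) : Prop :=
  ∀ x : N, ∃ U ∈ 𝓝 x, ∀ L : Set (Cn m), IsCompact L → L ⊆ Ω → ∃ L' : Set (Cn m), IsCompact L' ∧
    L' ⊆ Ω ∧ ∀ n, ∀ y ∈ U, f n y ∈ L → ∀ z ∈ U, f n z ∈ L'

section Control

variable {N : Type*} [TopologicalSpace N] {m : ℕ} {Ω : Set (Cn m)} {f : ℕ → N → Cn m}

theorem HasLocalization.locallyControlled {c : ℝ} (h : HasLocalization Ω c)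
    (hfΩ : ∀ n x, f n x ∈ Ω)
    (hdisc : ∀ x : N, ∃ U ∈ 𝓝 x, ∀ y ∈ U, ∀ z ∈ U, ∃ (d : ℂ → N) (ζ : ℂ), ‖ζ‖ < c ∧ d 0 = y ∧
      d ζ = z ∧ ∀ n, DifferentiableOn ℂ (fun w => f n (d w)) (ball 0 1)) :
    LocallyControlled Ω f := by
  intro x
  obtain ⟨U, hU, hUd⟩ := hdisc x
  refine ⟨U, hU, fun L hL hLΩ => ?_⟩
  obtain ⟨L', hL', hL'Ω, hd⟩ := h L hL hLΩ
  refine ⟨L', hL', hL'Ω, fun n y hy hyL z hz => ?_⟩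
  obtain ⟨d, ζ, hζ, rfl, rfl, hdiff⟩ := hUd y hy z hz
  exact hd _ (hdiff n) (fun w _ => hfΩ n _) hyL ζ hζ

theorem LocallyControlled.comp (h : LocallyControlled Ω f) (σ : ℕ → ℕ) :
    LocallyControlled Ω fun n => f (σ n) := by
  intro x
  obtain ⟨U, hU, hUL⟩ := h x
  refine ⟨U, hU, fun L hL hLΩ => ?_⟩
  obtain ⟨L', hL', hL'Ω, hd⟩ := hUL L hL hLΩ
  exact ⟨L', hL', hL'Ω, fun n => hd (σ n)⟩

/-- On a connected space, a locally controlled sequence that is eventually bounded inside `Ω` at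
one point is eventually locally bounded inside `Ω`. -/
theorem LocallyControlled.eventually_mem [PreconnectedSpace N] (h : LocallyControlled Ω f)
    {x₀ : N} {L₀ : Set (Cn m)} (hL₀ : IsCompact L₀) (hL₀Ω : L₀ ⊆ Ω)
    (hx₀ : ∀ᶠ n in atTop, f n x₀ ∈ L₀) (x : N) :
    ∃ U ∈ 𝓝 x, ∃ L : Set (Cn m), IsCompact L ∧ L ⊆ Ω ∧ ∀ᶠ n in atTop, ∀ z ∈ U, f n z ∈ L := by
  -- The neighbourhoods in `LocallyControlled` do not depend on `L`, so each lies in `G` or misses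
  -- it; thus `G` is open and closed.
  set G : Set N := {x | ∃ L : Set (Cn m), IsCompact L ∧ L ⊆ Ω ∧ ∀ᶠ n in atTop, f n x ∈ L} with hG
  have key : ∀ x, ∃ U ∈ 𝓝 x, ∀ y ∈ U, y ∈ G → ∃ L : Set (Cn m), IsCompact L ∧ L ⊆ Ω ∧
      ∀ᶠ n in atTop, ∀ z ∈ U, f n z ∈ L := by
    intro x
    obtain ⟨U, hU, hUL⟩ := h x
    refine ⟨U, hU, fun y hy ⟨L, hL, hLΩ, hev⟩ => ?_⟩
    obtain ⟨L', hL', hL'Ω, hd⟩ := hUL L hL hLΩ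
    exact ⟨L', hL', hL'Ω, hev.mono fun n hn z hz => hd n y hy hn z hz⟩
  have hGU : ∀ x, ∃ U ∈ 𝓝 x, ∀ y ∈ U, y ∈ G → U ⊆ G := fun x => by
    obtain ⟨U, hU, hUG⟩ := key x
    refine ⟨U, hU, fun y hy hyG z hz => ?_⟩
    obtain ⟨L, hL, hLΩ, hev⟩ := hUG y hy hyG
    exact ⟨L, hL, hLΩ, hev.mono fun n hn => hn z hz⟩
  have hclopen : IsClopen G := by
    refine ⟨⟨isOpen_iff_mem_nhds.2 fun x hx => ?_⟩, isOpen_iff_mem_nhds.2 fun x hx => ?_⟩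
    · obtain ⟨U, hU, hUG⟩ := hGU x
      filter_upwards [hU] with y hy hyG
      exact hx (hUG y hy hyG (mem_of_mem_nhds hU))
    · obtain ⟨U, hU, hUG⟩ := hGU x
      exact mem_of_superset hU (hUG x (mem_of_mem_nhds hU) hx)
  have huniv := hclopen.eq_univ ⟨x₀, L₀, hL₀, hL₀Ω, hx₀⟩
  obtain ⟨U, hU, hUG⟩ := key x
  exact ⟨U, hU, hUG x (mem_of_mem_nhds hU) (huniv ▸ mem_univ x)⟩

end Control

/-- Points of a small ball are joined, within a larger ball, by short linear discs. -/
theorem exists_linear_disc {E : Type*} [NormedAddCommGroup E] [NormedSpace ℂ E] {c R : ℝ}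
    (hc : 0 < c) (hR : 0 < R) : ∃ r > 0, r ≤ R ∧ ∀ x₀ : E, ∀ y ∈ ball x₀ r, ∀ z ∈ ball x₀ r,
      ∃ (v : E) (ζ : ℂ), ‖ζ‖ < c ∧ y + ζ • v = z ∧
        ∀ w ∈ ball (0 : ℂ) 1, y + w • v ∈ ball x₀ R := by
  have hc4 : 0 < 1 + 4 / c := by positivity
  refine ⟨R / (1 + 4 / c), by positivity, div_le_self hR.le (by simp; positivity),
    fun x₀ y hy z hz => ?_⟩
  set r := R / (1 + 4 / c) with hr
  -- The parameter `c / 2` reaches `z`; the whole unit disc then moves at most `(4 / c) r` from `y`,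
  -- which fixes `r = R / (1 + 4 / c)`.
  refine ⟨((2 / c : ℝ) : ℂ) • (z - y), ((c / 2 : ℝ) : ℂ), ?_, ?_, fun w hw => ?_⟩
  · rw [Complex.norm_real, Real.norm_of_nonneg (by positivity)]
    linarith
  · rw [smul_smul, ← Complex.ofReal_mul, show c / 2 * (2 / c) = 1 by field_simp,
      Complex.ofReal_one, one_smul, add_sub_cancel]
  · rw [mem_ball_zero_iff] at hw
    rw [mem_ball, dist_eq_norm] at hy hz
    have h1 : ‖z - y‖ ≤ 2 * r := by
      calc ‖z - y‖ = ‖(z - x₀) - (y - x₀)‖ := by congr 1; abel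
        _ ≤ ‖z - x₀‖ + ‖y - x₀‖ := norm_sub_le _ _
        _ ≤ 2 * r := by linarith
    have h2 : ‖w • ((2 / c : ℝ) : ℂ) • (z - y)‖ ≤ 4 / c * r := by
      rw [norm_smul, norm_smul, Complex.norm_real, Real.norm_of_nonneg (by positivity)]
      calc ‖w‖ * (2 / c * ‖z - y‖) ≤ 1 * (2 / c * (2 * r)) := by gcongr
        _ = _ := by ring
    rw [mem_ball, dist_eq_norm]
    calc ‖y + w • ((2 / c : ℝ) : ℂ) • (z - y) - x₀‖
        = ‖(y - x₀) + w • ((2 / c : ℝ) : ℂ) • (z - y)‖ := by congr 1; abel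
      _ ≤ ‖y - x₀‖ + ‖w • ((2 / c : ℝ) : ℂ) • (z - y)‖ := norm_add_le _ _
      _ < r + 4 / c * r := by linarith
      _ = R := by rw [hr]; field_simp

/-- Sequential form of the Arzelà–Ascoli theorem. -/
theorem exists_tendstoLocallyUniformly_of_equicontinuous {X E : Type*} [TopologicalSpace X]
    [LocallyCompactSpace X] [SecondCountableTopology X] [MetricSpace E] {f : ℕ → X → E}
    (hf : Equicontinuous f) (hQ : ∀ x, ∃ Q, IsCompact Q ∧ ∀ n, f n x ∈ Q) :
    ∃ (σ : ℕ → ℕ) (g : X → E), StrictMono σ ∧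
      TendstoLocallyUniformly (fun n => f (σ n)) g atTop := by
  choose Q hQc hfQ using hQ
  -- The pointwise closure is compact by Tychonoff and still equicontinuous, so it consists of
  -- continuous maps.
  set A := closure (range f) with hA
  have hAeq : Set.Equicontinuous A := by
    have : Set.Equicontinuous (range f) := equicontinuous_iff_range.1 hf
    exact this.closure
  have hAc : IsCompact A := by
    refine (isCompact_univ_pi hQc).of_isClosed_subset isClosed_closure (closure_minimal ?_ ?_)
    · rintro _ ⟨n, rfl⟩ x _
      exact hfQ x n
    · exact isClosed_set_pi fun x _ => (hQc x).isClosed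
  have hAcont : ∀ a ∈ A, Continuous a := fun a ha => hAeq.continuous ⟨a, ha⟩
  set S : Set C(X, E) := {a | (a : X → E) ∈ A} with hS
  have hSc : IsCompact S := by
    refine ArzelaAscoli.isCompact_of_equicontinuous S ?_ ?_
    · convert hAc
      ext a
      constructor
      · rintro ⟨b, hb, rfl⟩
        exact hb
      · exact fun ha => ⟨⟨a, hAcont a ha⟩, ha, rfl⟩
    · exact hAeq.comp fun a : S => (⟨a.1, a.2⟩ : A)
  obtain ⟨g, -, σ, hσ, hlim⟩ := hSc.tendsto_subseq
    (x := fun n => (⟨f n, hf.continuous n⟩ : C(X, E))) fun n => subset_closure (mem_range_self n)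
  exact ⟨σ, g, hσ, ContinuousMap.tendsto_iff_tendstoLocallyUniformly.1 hlim⟩

/-! ### Montel's theorem on complex manifolds and tautness -/

section Manifold

variable {k m : ℕ} {N : Type*} [TopologicalSpace N] [ChartedSpace (Cn k) N]

theorem differentiableOn_comp_chartAt_symm [IsManifold 𝓘(ℂ, Cn k) ω N] {f : N → Cn m}
    (hf : MDifferentiable 𝓘(ℂ, Cn k) 𝓘(ℂ, Cn m) f) (x : N) :
    DifferentiableOn ℂ (fun w => f ((chartAt (Cn k) x).symm w)) (chartAt (Cn k) x).target := by
  have : IsManifold 𝓘(ℂ, Cn k) 1 N := IsManifold.of_le (n := ω) (by simp)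
  rw [← mdifferentiableOn_iff_differentiableOn]
  exact hf.comp_mdifferentiableOn (mdifferentiable_chart x).2

theorem mdifferentiableAt_of_differentiableAt_chartAt {g : N → Cn m} {x : N}
    (hc : ContinuousAt g x)
    (hg : DifferentiableAt ℂ (fun w => g ((chartAt (Cn k) x).symm w)) (chartAt (Cn k) x x)) :
    MDifferentiableAt 𝓘(ℂ, Cn k) 𝓘(ℂ, Cn m) g x := by
  rw [mdifferentiableAt_iff]
  refine ⟨hc, ?_⟩
  exact hg.differentiableWithinAt

theorem exists_ball_subset_chartAt_target (x : N) {U : Set N} (hU : U ∈ 𝓝 x) :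
    ∃ R > 0, ball (chartAt (Cn k) x x) R ⊆ (chartAt (Cn k) x).target ∧
      ∀ w ∈ ball (chartAt (Cn k) x x) R, (chartAt (Cn k) x).symm w ∈ U := by
  have h1 : (chartAt (Cn k) x).target ∈ 𝓝 (chartAt (Cn k) x x) :=
    (chartAt (Cn k) x).open_target.mem_nhds (mem_chart_target (Cn k) x)
  have h2 : (chartAt (Cn k) x).symm ⁻¹' U ∈ 𝓝 (chartAt (Cn k) x x) := by
    refine ((chartAt (Cn k) x).continuousAt_symm (mem_chart_target (Cn k) x)).preimage_mem_nhds ?_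
    rwa [(chartAt (Cn k) x).left_inv (mem_chart_source (Cn k) x)]
  obtain ⟨R, hR, hsub⟩ := Metric.mem_nhds_iff.1 (inter_mem h1 h2)
  exact ⟨R, hR, fun w hw => (hsub hw).1, fun w hw => (hsub hw).2⟩

/-- Points close to `x` lie on short holomorphic discs through each other. -/
theorem exists_nhds_disc [IsManifold 𝓘(ℂ, Cn k) ω N] {c : ℝ} (hc : 0 < c) (x : N) :
    ∃ U ∈ 𝓝 x, ∀ y ∈ U, ∀ z ∈ U, ∃ (d : ℂ → N) (ζ : ℂ), ‖ζ‖ < c ∧ d 0 = y ∧ d ζ = z ∧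
      ∀ f : N → Cn m, MDifferentiable 𝓘(ℂ, Cn k) 𝓘(ℂ, Cn m) f →
        DifferentiableOn ℂ (fun w => f (d w)) (ball 0 1) := by
  set e := chartAt (Cn k) x with he
  obtain ⟨R, hR, hRt, -⟩ := exists_ball_subset_chartAt_target (k := k) x (univ_mem)
  obtain ⟨r, hr0, -, hdisc⟩ := exists_linear_disc (E := Cn k) hc hR
  refine ⟨e.source ∩ e ⁻¹' ball (e x) r, ?_, ?_⟩
  · exact (e.isOpen_inter_preimage isOpen_ball).mem_nhds
      ⟨mem_chart_source (Cn k) x, mem_ball_self hr0⟩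
  rintro y ⟨hys, hy⟩ z ⟨hzs, hz⟩
  obtain ⟨v, ζ, hζ, hz', hmem⟩ := hdisc (e x) (e y) hy (e z) hz
  refine ⟨fun w => e.symm (e y + w • v), ζ, hζ, ?_, ?_, fun f hf => ?_⟩
  · simp [e.left_inv hys]
  · simp only
    rw [hz', e.left_inv hzs]
  · exact (differentiableOn_comp_chartAt_symm hf x).comp (t := e.target)
      (f := fun w : ℂ => e y + w • v) (by fun_prop) fun w hw => hRt (hmem w hw)

/-- **Montel's theorem**: an eventually locally bounded sequence of holomorphic maps on a complex
manifold has a subsequence that converges locally uniformly to a holomorphic map. -/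
theorem exists_tendstoLocallyUniformly_of_bounded [IsManifold 𝓘(ℂ, Cn k) ω N]
    [SecondCountableTopology N] {f : ℕ → N → Cn m}
    (hf : ∀ n, MDifferentiable 𝓘(ℂ, Cn k) 𝓘(ℂ, Cn m) (f n))
    (hb : ∀ x : N, ∃ U ∈ 𝓝 x, ∃ L : Set (Cn m), IsCompact L ∧
      ∀ᶠ n in atTop, ∀ z ∈ U, f n z ∈ L) :
    ∃ (σ : ℕ → ℕ) (g : N → Cn m), StrictMono σ ∧
      MDifferentiable 𝓘(ℂ, Cn k) 𝓘(ℂ, Cn m) g ∧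
      TendstoLocallyUniformly (fun n => f (σ n)) g atTop := by
  have : LocallyCompactSpace N := ChartedSpace.locallyCompactSpace (Cn k) N
  have heq : Equicontinuous f := by
    intro x
    rw [Metric.equicontinuousAt_iff_right]
    intro ε hε
    obtain ⟨U, hU, L, hL, hev⟩ := hb x
    set e := chartAt (Cn k) x with he
    obtain ⟨R, hR, hRt, hRU⟩ := exists_ball_subset_chartAt_target (k := k) x hU
    obtain ⟨M, hM0, hM⟩ := hL.isBounded.exists_pos_norm_le
    obtain ⟨n₀, hn₀⟩ := eventually_atTop.1 hev
    have hlarge : ∀ᶠ y in 𝓝 x, ∀ n, n₀ ≤ n → dist (f n x) (f n y) < ε := by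
      have h1 : ContinuousAt e x := e.continuousAt (mem_chart_source (Cn k) x)
      -- By the Schwarz lemma `2 M / R` controls the variation from the chart centre for all `n ≥
      -- n₀`.
      have hδ : 0 < ε * R / (2 * M) := by positivity
      filter_upwards [h1.eventually (ball_mem_nhds (e x) hR),
        h1.eventually (ball_mem_nhds (e x) hδ), e.open_source.mem_nhds (mem_chart_source (Cn k) x)]
        with y hyR hyδ hys n hn
      have hmaps : MapsTo (fun w => f n (e.symm w)) (ball (e x) R)
          (closedBall (f n (e.symm (e x))) (2 * M)) := by
        intro w hw
        rw [mem_closedBall, dist_eq_norm, two_mul]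
        exact (norm_sub_le _ _).trans (add_le_add (hM _ (hn₀ n hn _ (hRU w hw)))
          (hM _ (hn₀ n hn _ (hRU _ (mem_ball_self hR)))))
      have h2 := Complex.dist_le_div_mul_dist_of_mapsTo_ball
        ((differentiableOn_comp_chartAt_symm (hf n) x).mono hRt) hmaps hyR
      rw [← he, e.left_inv hys, e.left_inv (mem_chart_source (Cn k) x)] at h2
      rw [dist_comm]
      refine h2.trans_lt ?_
      rw [lt_div_iff₀ (by positivity)] at hyδ
      rw [div_mul_eq_mul_div, div_lt_iff₀ hR]
      linarith
    -- The finitely many earlier maps need no common bound: each is continuous.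
    have hsmall : ∀ᶠ y in 𝓝 x, ∀ n ∈ Finset.range n₀, dist (f n x) (f n y) < ε := by
      rw [Filter.eventually_all_finset]
      intro n _
      have := (hf n).continuous.continuousAt (x := x)
      filter_upwards [this.eventually (ball_mem_nhds _ hε)] with y hy
      rwa [dist_comm]
    filter_upwards [hlarge, hsmall] with y h1 h2 n
    rcases lt_or_ge n n₀ with h | h
    · exact h2 n (Finset.mem_range.2 h)
    · exact h1 n h
  have hQ : ∀ x, ∃ Q, IsCompact Q ∧ ∀ n, f n x ∈ Q := by
    intro x
    obtain ⟨U, hU, L, hL, hev⟩ := hb x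
    obtain ⟨n₀, hn₀⟩ := eventually_atTop.1 hev
    refine ⟨L ∪ (fun n => f n x) '' (Finset.range n₀), hL.union
      ((Finset.finite_toSet _).image _).isCompact, fun n => ?_⟩
    rcases lt_or_ge n n₀ with h | h
    · exact Or.inr ⟨n, by simpa using h, rfl⟩
    · exact Or.inl (hn₀ n h x (mem_of_mem_nhds hU))
  obtain ⟨σ, g, hσ, hlim⟩ := exists_tendstoLocallyUniformly_of_equicontinuous heq hQ
  refine ⟨σ, g, hσ, fun x => ?_, hlim⟩
  have hgc : Continuous g := hlim.continuous (Frequently.of_forall fun n => (hf _).continuous)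
  refine mdifferentiableAt_of_differentiableAt_chartAt hgc.continuousAt ?_
  set e := chartAt (Cn k) x with he
  obtain ⟨R, hR, hRt, -⟩ := exists_ball_subset_chartAt_target (k := k) x (univ_mem)
  have hR2 : closedBall (e x) (R / 2) ⊆ e.target :=
    (closedBall_subset_ball (by linarith)).trans hRt
  refine differentiableAt_of_tendstoUniformlyOn_ball (R := R / 2) (by positivity)
    (f := fun n w => f (σ n) (e.symm w)) (fun n => (differentiableOn_comp_chartAt_symm (hf _) x).mono
      (ball_subset_closedBall.trans hR2)) ?_
  have hK : IsCompact (e.symm '' closedBall (e x) (R / 2)) :=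
    (isCompact_closedBall _ _).image_of_continuousOn (e.continuousOn_symm.mono hR2)
  have h1 := (tendstoLocallyUniformlyOn_iff_tendstoUniformlyOn_of_compact hK).1
    hlim.tendstoLocallyUniformlyOn
  exact (h1.comp e.symm).mono fun w hw => mem_image_of_mem _ (ball_subset_closedBall hw)

end Manifold

theorem HasLocalization.isTaut {m : ℕ} {Ω : Set (Cn m)} {c : ℝ} (hc : 0 < c)
    (h : HasLocalization Ω c) : IsTaut.{u} Ω := by
  intro k N _ _ _ _ _ _ f hf
  by_cases hdiv : ∀ K : Set N, IsCompact K → ∀ L : Set (Cn m), IsCompact L → L ⊆ Ω →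
      ∀ᶠ n in atTop, Disjoint (f n '' K) L
  · exact ⟨id, strictMono_id, Or.inr hdiv⟩
  push Not at hdiv
  obtain ⟨K, hK, L, hL, hLΩ, hfreq⟩ := hdiv
  obtain ⟨σ₁, hσ₁, hmeet⟩ := extraction_of_frequently_atTop hfreq
  have hmeet' : ∀ n, ∃ x ∈ K, f (σ₁ n) x ∈ L := fun n => by
    obtain ⟨_, ⟨x, hx, rfl⟩, hxL⟩ := not_disjoint_iff.1 (hmeet n)
    exact ⟨x, hx, hxL⟩
  choose x hxK hxL using hmeet'
  obtain ⟨a, -, σ₂, hσ₂, ha⟩ := hK.tendsto_subseq hxK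
  have hctrl : LocallyControlled Ω f := h.locallyControlled (fun n => (hf n).2) fun x => by
    obtain ⟨U, hU, hUd⟩ := exists_nhds_disc (m := m) (k := k) hc x
    refine ⟨U, hU, fun y hy z hz => ?_⟩
    obtain ⟨d, ζ, h1, h2, h3, h4⟩ := hUd y hy z hz
    exact ⟨d, ζ, h1, h2, h3, fun n => h4 _ (hf n).1⟩
  obtain ⟨U, hU, hUL⟩ := hctrl a
  obtain ⟨L', hL', hL'Ω, hd⟩ := hUL L hL hLΩ
  -- Localization moves the bound from the varying points `x (σ₂ n)` to their limit `a`.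
  have hev : ∀ᶠ n in atTop, f (σ₁ (σ₂ n)) a ∈ L' := by
    filter_upwards [ha.eventually hU] with n hn
    exact hd _ _ hn (hxL (σ₂ n)) a (mem_of_mem_nhds hU)
  have hloc := (hctrl.comp fun n => σ₁ (σ₂ n)).eventually_mem hL' hL'Ω hev
  obtain ⟨σ₃, g, hσ₃, hg, hlim⟩ := exists_tendstoLocallyUniformly_of_bounded
    (f := fun n => f (σ₁ (σ₂ n))) (fun n => (hf _).1) fun x => by
      obtain ⟨U, hU, L, hL, -, hev⟩ := hloc x
      exact ⟨U, hU, L, hL, hev⟩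
  refine ⟨fun n => σ₁ (σ₂ (σ₃ n)), hσ₁.comp (hσ₂.comp hσ₃), Or.inl ⟨g, ⟨hg, fun y => ?_⟩, hlim⟩⟩
  obtain ⟨U, hU, L, hL, hLΩ, hev⟩ := hloc y
  refine hLΩ (hL.isClosed.mem_of_tendsto 
    ((hlim.tendstoLocallyUniformlyOn (s := univ)).tendsto_at (mem_univ y)) ?_)
  filter_upwards [hσ₃.tendsto_atTop.eventually hev] with n hn
  exact hn y (mem_of_mem_nhds hU)

/-! ### The continuity principle -/

/-- Real continuous functions on the unit circle are uniformly approximated by real parts of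
entire functions. -/
theorem exists_entire_re_approx {v : ℂ → ℝ} (hv : ContinuousOn v (sphere 0 1)) {ε : ℝ}
    (hε : 0 < ε) : ∃ p : ℂ → ℂ, Differentiable ℂ p ∧ ∀ ζ ∈ sphere (0 : ℂ) 1, |(p ζ).re - v ζ| < ε := by
  have : Fact (0 < 2 * Real.pi) := ⟨Real.two_pi_pos⟩
  let V : C(AddCircle (2 * Real.pi), ℂ) :=
    ⟨fun x => (v (AddCircle.toCircle x : ℂ) : ℂ), Complex.continuous_ofReal.comp
      (hv.comp_continuous (continuous_subtype_val.comp AddCircle.continuous_toCircle)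
        fun x => mem_sphere_zero_iff_norm.2 (Circle.norm_coe _))⟩
  have hV : V ∈ (Submodule.span ℂ (range (@fourier (2 * Real.pi)))).topologicalClosure := by
    rw [span_fourier_closure_eq_top]
    exact Submodule.mem_top
  obtain ⟨W, hW, hdist⟩ := Metric.mem_closure_iff.1 hV ε hε
  -- Negative Fourier modes are conjugates of positive powers on the circle, and `p + conj q` has
  -- the same real part as the entire function `p + q`.
  have hspan : ∃ p q : ℂ → ℂ, Differentiable ℂ p ∧ Differentiable ℂ q ∧
      ∀ x, W x = p (AddCircle.toCircle x : ℂ) +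
        (starRingEnd ℂ) (q (AddCircle.toCircle x : ℂ)) := by
    refine Submodule.span_induction ?_ ?_ ?_ ?_ hW
    · rintro _ ⟨n, rfl⟩
      rcases n with n | n
      · refine ⟨fun z => z ^ n, fun _ => 0, by fun_prop, by fun_prop, fun x => ?_⟩
        rw [fourier_apply, AddCircle.toCircle_zsmul]
        simp
      · refine ⟨fun _ => 0, fun z => z ^ (n + 1), by fun_prop, by fun_prop, fun x => ?_⟩
        rw [fourier_apply, AddCircle.toCircle_zsmul, zpow_negSucc, Circle.coe_inv_eq_conj]
        simp
    · exact ⟨fun _ => 0, fun _ => 0, by fun_prop, by fun_prop, fun x => by simp⟩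
    · rintro W₁ W₂ - - ⟨p₁, q₁, hp₁, hq₁, h₁⟩ ⟨p₂, q₂, hp₂, hq₂, h₂⟩
      refine ⟨fun z => p₁ z + p₂ z, fun z => q₁ z + q₂ z, hp₁.add hp₂, hq₁.add hq₂, fun x => ?_⟩
      rw [ContinuousMap.add_apply, h₁, h₂, map_add]
      ring
    · rintro a W₁ - ⟨p, q, hp, hq, h⟩
      refine ⟨fun z => a * p z, fun z => (starRingEnd ℂ) a * q z, hp.const_mul _, hq.const_mul _,
        fun x => ?_⟩
      rw [ContinuousMap.smul_apply, h, map_mul, Complex.conj_conj, smul_eq_mul]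
      ring
  obtain ⟨p, q, hp, hq, hpq⟩ := hspan
  refine ⟨fun z => p z + q z, hp.add hq, fun ζ hζ => ?_⟩
  rw [mem_sphere_zero_iff_norm] at hζ
  obtain ⟨x, hx⟩ : ∃ x : AddCircle (2 * Real.pi), (AddCircle.toCircle x : ℂ) = ζ := by
    refine ⟨(Complex.arg ζ : ℝ), ?_⟩
    rw [AddCircle.toCircle_apply_mk, div_self Real.two_pi_pos.ne', one_mul, Circle.coe_exp]
    simpa [hζ] using Complex.norm_mul_exp_arg_mul_I ζ
  have h1 : ‖V x - W x‖ < ε := by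
    rw [← dist_eq_norm]
    exact (ContinuousMap.dist_apply_le_dist x).trans_lt hdist
  have h2 : (V x - W x).re = v ζ - (p ζ + q ζ).re := by
    rw [Complex.sub_re, hpq, hx]
    simp [V, hx]
  rw [abs_sub_comm, ← h2]
  exact (Complex.abs_re_le_norm _).trans_lt h1

theorem circleAverage_re_of_differentiable {p : ℂ → ℂ} (hp : Differentiable ℂ p) :
    Real.circleAverage (fun z => (p z).re) 0 1 = (p 0).re := by
  have h1 := Complex.reCLM.circleAverage_comp_comm (f := p) (c := 0) (R := 1)
    hp.continuous.continuousOn.circleIntegrable'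
  rw [hp.diffContOnCl.circleAverage] at h1
  exact h1

/-- **Continuity principle**: if a continuous family of entire discs has all its boundaries in
`Ω` and its initial disc in `Ω`, then the final disc is in `Ω`. -/
theorem HasLocalization.continuity_principle {m : ℕ} {Ω : Set (Cn m)} {c : ℝ} (hc : 0 < c)
    (h : HasLocalization Ω c) (hΩ : IsOpen Ω) {F : ℝ → ℂ → Cn m}
    (hF : Continuous fun x : ℝ × ℂ => F x.1 x.2) (hFd : ∀ t, Differentiable ℂ (F t))
    (hF0 : ∀ ζ ∈ closedBall (0 : ℂ) 1, F 0 ζ ∈ Ω)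
    (hFs : ∀ t ∈ Icc (0 : ℝ) 1, ∀ ζ ∈ sphere (0 : ℂ) 1, F t ζ ∈ Ω) :
    ∀ ζ ∈ closedBall (0 : ℂ) 1, F 1 ζ ∈ Ω := by
  set S : Set ℝ := {t | ∀ ζ ∈ closedBall (0 : ℂ) 1, F t ζ ∈ Ω} with hS
  have hSopen : IsOpen S := isOpen_iff_mem_nhds.2 fun t ht =>
    (isCompact_closedBall (0 : ℂ) 1).eventually_forall_of_forall_eventually fun ζ hζ =>
      hF.continuousAt.eventually (hΩ.mem_nhds (ht ζ hζ))
  have hSclosed : IsClosed (S ∩ Icc 0 1) := by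
    refine isClosed_of_closure_subset fun t ht => ?_
    obtain ⟨a, ha, hlim⟩ := mem_closure_iff_seq_limit.1 ht
    have ht01 : t ∈ Icc (0 : ℝ) 1 :=
      isClosed_Icc.mem_of_tendsto hlim (Eventually.of_forall fun n => (ha n).2)
    refine ⟨fun ζ hζ => ?_, ht01⟩
    have hlimF : ∀ ζ, Tendsto (fun n => F (a n) ζ) atTop (𝓝 (F t ζ)) := fun ζ =>
      (hF.tendsto (t, ζ)).comp (hlim.prodMk_nhds tendsto_const_nhds)
    rcases eq_or_lt_of_le (mem_closedBall_zero_iff.1 hζ) with h1 | h1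
    · exact hFs t ht01 ζ (mem_sphere_zero_iff_norm.2 h1)
    set N := ball (0 : ℂ) 1
    have : PreconnectedSpace N := isPreconnected_iff_preconnectedSpace.1
      (convex_ball (0 : ℂ) 1).isPreconnected
    have hctrl : LocallyControlled Ω fun n (x : N) => F (a n) x := by
      refine h.locallyControlled (fun n x => (ha n).1 x (ball_subset_closedBall x.2)) fun x => ?_
      obtain ⟨R, hR, hRN⟩ := Metric.isOpen_iff.1 isOpen_ball x.1 x.2
      obtain ⟨r, hr, hrR, hdisc⟩ := exists_linear_disc (E := ℂ) hc hR
      refine ⟨Subtype.val ⁻¹' ball x.1 r, continuous_subtype_val.continuousAt.preimage_mem_nhds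
        (ball_mem_nhds _ hr), fun y hy z hz => ?_⟩
      obtain ⟨v, ζ, hζ, hz', hmem⟩ := hdisc x.1 y.1 hy z.1 hz
      classical
      -- The filler value `y` is attained neither at `0`, nor at `ζ`, nor on the unit disc.
      refine ⟨fun w => if hw : y.1 + w • v ∈ N then ⟨y.1 + w • v, hw⟩ else y, ζ, hζ, ?_, ?_,
        fun n => ?_⟩
      · simp
      · have h2 : y.1 + ζ • v ∈ N := hz' ▸ z.2
        simp only
        rw [dif_pos h2]
        exact Subtype.ext hz'
      · have h2 : DifferentiableOn ℂ (fun w : ℂ => F (a n) (y.1 + w • v)) (ball 0 1) :=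
          ((hFd (a n)).comp (by fun_prop)).differentiableOn
        refine h2.congr fun w hw => ?_
        simp only
        rw [dif_pos (hRN (hmem w hw))]
    have h1Ω : F t 1 ∈ Ω := hFs t ht01 1 (by simp)
    have hcont : Continuous (F t) := (hFd t).continuous
    -- The limit disc is in `Ω` on the circle, hence at an interior point `ρ` near `1`; there the
    -- approximating discs are eventually in a compact subset of `Ω`, which starts the propagation.
    obtain ⟨ρ, hρ, hρN⟩ : ∃ ρ : ℂ, F t ρ ∈ Ω ∧ ρ ∈ N := by
      have h2 : (1 : ℂ) ∈ closure N := by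
        rw [closure_ball _ one_ne_zero]
        simp
      exact mem_closure_iff.1 h2 _ (hΩ.preimage hcont) h1Ω
    obtain ⟨δ, hδ, hδΩ⟩ := Metric.nhds_basis_closedBall.mem_iff.1 (hΩ.mem_nhds hρ)
    obtain ⟨U, hU, L, hL, hLΩ, hev⟩ := hctrl.eventually_mem (x₀ := ⟨ρ, hρN⟩)
      (isCompact_closedBall _ _) hδΩ ((hlimF ρ).eventually (closedBall_mem_nhds _ hδ))
      ⟨ζ, mem_ball_zero_iff.2 h1⟩
    exact hLΩ (hL.isClosed.mem_of_tendsto (hlimF ζ)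
      (hev.mono fun n hn => hn _ (mem_of_mem_nhds hU)))
  exact (hSclosed.Icc_subset_of_forall_mem_nhdsWithin hF0 fun t ht =>
    mem_nhdsWithin_of_mem_nhds (hSopen.mem_nhds ht.1)) (right_mem_Icc.2 zero_le_one)

/-! ### The distance to the complement and the exhaustion function -/

section Distance

variable {m : ℕ} {Ω : Set (Cn m)}

theorem infDist_compl_pos (hΩ : IsOpen Ω) (hne : Ωᶜ.Nonempty) {z : Cn m} (hz : z ∈ Ω) :
    0 < infDist z Ωᶜ :=
  (hΩ.isClosed_compl.notMem_iff_infDist_pos hne).1 fun h => h hz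

theorem continuousOn_neg_log_infDist (hΩ : IsOpen Ω) :
    ContinuousOn (fun z => -Real.log (infDist z Ωᶜ)) Ω := by
  rcases Ωᶜ.eq_empty_or_nonempty with he | hne
  -- For `Ω = ℂ^m` the conventions `infDist z ∅ = 0` and `log 0 = 0` make the function zero.
  · simp only [he, infDist_empty]
    exact continuousOn_const
  · exact ((continuous_infDist_pt _).continuousOn.log fun z hz =>
      (infDist_compl_pos hΩ hne hz).ne').neg

/-- The sub-mean value inequality for `-log dist(·, Ωᶜ)`. -/
theorem HasLocalization.neg_log_infDist_le {c : ℝ} (hc : 0 < c) (h : HasLocalization Ω c)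
    (hΩ : IsOpen Ω) {a b : Cn m} (hab : ∀ ζ : ℂ, ‖ζ‖ ≤ 1 → a + ζ • b ∈ Ω) :
    -Real.log (infDist a Ωᶜ) ≤
      Real.circleAverage (fun ζ : ℂ => -Real.log (infDist (a + ζ • b) Ωᶜ)) 0 1 := by
  rcases Ωᶜ.eq_empty_or_nonempty with he | hne
  · simp only [he, infDist_empty]
    rw [Real.circleAverage_const]
  set v : ℂ → ℝ := fun ζ => -Real.log (infDist (a + ζ • b) Ωᶜ) with hv
  have hvc : ContinuousOn v (sphere 0 1) :=
    (continuousOn_neg_log_infDist hΩ).comp (f := fun ζ : ℂ => a + ζ • b) (by fun_prop)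
      fun ζ hζ => hab ζ (mem_sphere_zero_iff_norm.1 hζ).le
  have haΩ : a ∈ Ω := by simpa using hab 0 (by simp)
  refine le_of_forall_pos_le_add fun ε hε => ?_
  obtain ⟨p, hp, hpv⟩ := exists_entire_re_approx hvc (half_pos hε)
  have hmean : (p 0).re ≤ Real.circleAverage v 0 1 + ε / 2 := by
    rw [← circleAverage_re_of_differentiable hp]
    have h1 : Real.circleAverage (fun z => (p z).re) 0 1 ≤
        Real.circleAverage (fun z => v z + ε / 2) 0 1 := by
      refine Real.circleAverage_mono
        (Complex.continuous_re.comp hp.continuous).continuousOn.circleIntegrable'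
        (ContinuousOn.circleIntegrable' (by
          rw [abs_one]
          exact hvc.add continuousOn_const)) fun z hz => ?_
      rw [abs_one] at hz
      have := (abs_lt.1 (hpv z hz)).2
      linarith
    rwa [Real.circleAverage_fun_add (ContinuousOn.circleIntegrable' (by simpa using hvc))
      continuousOn_const.circleIntegrable', Real.circleAverage_const] at h1
  suffices hmain : -Real.log (infDist a Ωᶜ) ≤ (p 0).re + ε / 2 by linarith
  by_contra! hlt
  obtain ⟨q, hq, hqa⟩ := hΩ.isClosed_compl.exists_infDist_eq_dist hne a
  have hδ : 0 < infDist a Ωᶜ := infDist_compl_pos hΩ hne haΩ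
  have hqn : ‖q - a‖ = infDist a Ωᶜ := by rw [hqa, dist_comm, dist_eq_norm]
  -- The affine disc is pushed towards a nearest point `q` of `Ωᶜ` so that `F 1 0 = q`. If the
  -- inequality fails, then on the circle the push has norm at most `|exp (p 0 - p ζ)| · dist(a,
  -- Ωᶜ)`, which is below `dist(a + ζ b, Ωᶜ)`. The boundaries stay in `Ω`, and the continuity
  -- principle would put `q` in `Ω`.
  set F : ℝ → ℂ → Cn m := fun t ζ =>
    (a + ζ • b) + ((t : ℂ) * Complex.exp (p 0 - p ζ)) • (q - a) with hF
  have hpc := hp.continuous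
  have hfin := h.continuity_principle hc hΩ (F := F) (by fun_prop) (fun t => by fun_prop)
    (fun ζ hζ => by simpa [hF] using hab ζ (mem_closedBall_zero_iff.1 hζ)) (fun t ht ζ hζ => by
      have hζΩ := hab ζ (mem_sphere_zero_iff_norm.1 hζ).le
      have hδζ := infDist_compl_pos hΩ hne hζΩ
      have hnorm : ‖((t : ℂ) * Complex.exp (p 0 - p ζ)) • (q - a)‖ < infDist (a + ζ • b) Ωᶜ := by
        rw [norm_smul, norm_mul, Complex.norm_real, Real.norm_of_nonneg ht.1, Complex.norm_exp,
          Complex.sub_re, hqn]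
        have h1 : infDist a Ωᶜ < Real.exp (-(p 0).re - ε / 2) := by
          rw [← Real.log_lt_iff_lt_exp hδ]
          linarith
        have h2 : Real.exp (-(p ζ).re - ε / 2) ≤ infDist (a + ζ • b) Ωᶜ := by
          rw [← Real.le_log_iff_exp_le hδζ]
          have := (abs_lt.1 (hpv ζ hζ)).1
          simp only [hv] at this
          linarith
        refine lt_of_lt_of_le ?_ h2
        calc t * Real.exp ((p 0).re - (p ζ).re) * infDist a Ωᶜ
            ≤ 1 * Real.exp ((p 0).re - (p ζ).re) * infDist a Ωᶜ := by
              gcongr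
              exact ht.2
          _ < 1 * Real.exp ((p 0).re - (p ζ).re) * Real.exp (-(p 0).re - ε / 2) := by
              gcongr
          _ = Real.exp (-(p ζ).re - ε / 2) := by
              rw [one_mul, ← Real.exp_add]
              congr 1
              ring
      by_contra hnot
      have h3 := infDist_le_dist_of_mem (x := a + ζ • b) (show F t ζ ∈ Ωᶜ from hnot)
      rw [dist_comm, dist_eq_norm] at h3
      simp only [hF, add_sub_cancel_left] at h3
      linarith) 0 (by simp)
  refine hq ?_
  simpa [hF] using hfin

/-- On the circle `‖a + ζ b‖²` exceeds the real part of the affine function `‖a‖² + 2 ζ ⟨a, b⟩` by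
`‖ζ b‖² ≥ 0`. -/
theorem norm_sq_le_circleAverage (a b : Cn m) :
    ‖a‖ ^ 2 ≤ Real.circleAverage (fun ζ : ℂ => ‖a + ζ • b‖ ^ 2) 0 1 := by
  set p : ℂ → ℂ := fun ζ => ((‖a‖ ^ 2 : ℝ) : ℂ) + 2 * (ζ * inner ℂ a b) with hp
  have h1 := circleAverage_re_of_differentiable (p := p) (by fun_prop)
  have h2 : (p 0).re = ‖a‖ ^ 2 := by simp only [hp, zero_mul, mul_zero, add_zero, Complex.ofReal_re]
  rw [← h2, ← h1]
  refine Real.circleAverage_mono (Continuous.continuousOn (by fun_prop)).circleIntegrable'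
    (Continuous.continuousOn (by fun_prop)).circleIntegrable' fun ζ _ => ?_
  rw [@norm_add_sq ℂ, inner_smul_right]
  have h3 : (p ζ).re = ‖a‖ ^ 2 + 2 * (ζ * inner ℂ a b).re := by
    simp only [hp, Complex.add_re, Complex.ofReal_re]
    simp
  rw [h3]
  simp only [RCLike.re_eq_complex_re]
  have := sq_nonneg ‖ζ • b‖
  linarith

/-- The term `-log dist(z, Ωᶜ)` keeps sublevel sets away from the boundary, and `‖z‖²` keeps them
bounded. -/
theorem HasLocalization.isPseudoconvex {c : ℝ} (hc : 0 < c) (h : HasLocalization Ω c)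
    (hΩ : IsOpen Ω) : IsPseudoconvex Ω := by
  set u : Cn m → ℝ := fun z => -Real.log (infDist z Ωᶜ) + ‖z‖ ^ 2 with hu
  have huc : ContinuousOn u Ω :=
    (continuousOn_neg_log_infDist hΩ).add (Continuous.continuousOn (by fun_prop))
  refine ⟨hΩ, u, huc, ⟨huc.upperSemicontinuousOn, fun a b hab => ?_⟩, fun C => ?_⟩
  · have hmaps : MapsTo (fun ζ : ℂ => a + ζ • b) (sphere 0 |1|) Ω := fun ζ hζ =>
      hab ζ (by simpa using (mem_sphere_zero_iff_norm.1 hζ).le)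
    have hline : ContinuousOn (fun ζ : ℂ => a + ζ • b) (sphere 0 |1|) := by fun_prop
    refine ⟨(huc.comp hline hmaps).circleIntegrable', ?_⟩
    have h1 := h.neg_log_infDist_le hc hΩ hab
    have h2 := norm_sq_le_circleAverage a b
    simp only [hu]
    rw [Real.circleAverage_fun_add (f₁ := fun ζ : ℂ => -Real.log (infDist (a + ζ • b) Ωᶜ))
      ((continuousOn_neg_log_infDist hΩ).comp hline hmaps).circleIntegrable'
      (Continuous.continuousOn (by fun_prop)).circleIntegrable']
    exact add_le_add h1 h2
  · obtain ⟨K, hK, hKΩ, hsub⟩ : ∃ K : Set (Cn m), IsCompact K ∧ K ⊆ Ω ∧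
        ∀ z ∈ Ω, u z ≤ C → z ∈ K := by
      rcases Ωᶜ.eq_empty_or_nonempty with he | hne
      · refine ⟨closedBall 0 (1 + |C|), isCompact_closedBall _ _, ?_, fun z _ hz => ?_⟩
        · rw [compl_empty_iff.1 he]
          exact subset_univ _
        · simp only [hu, he, infDist_empty, Real.log_zero, neg_zero, zero_add] at hz
          rw [mem_closedBall_zero_iff]
          nlinarith [le_abs_self C, abs_nonneg C, norm_nonneg z]
      · obtain ⟨q, hq⟩ := hne
        -- At infinity `-log dist` decreases at most linearly, by `log d ≤ d - 1` and `d ≤ ‖z‖ +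
        -- ‖q‖`, so `‖z‖²` wins outside this ball.
        refine ⟨closedBall 0 (2 + |C| + ‖q‖) ∩ {z | Real.exp (-C) ≤ infDist z Ωᶜ},
          (isCompact_closedBall _ _).inter_right
            (isClosed_le continuous_const (continuous_infDist_pt _)), ?_, fun z hz hzC => ⟨?_, ?_⟩⟩
        · rintro z ⟨-, hz⟩
          by_contra hzΩ
          have h1 : infDist z Ωᶜ = 0 := infDist_zero_of_mem hzΩ
          rw [mem_ofPred_eq, h1] at hz
          exact absurd hz (Real.exp_pos _).not_ge
        · have hpos := infDist_compl_pos hΩ ⟨q, hq⟩ hz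
          have h1 : infDist z Ωᶜ ≤ ‖z‖ + ‖q‖ :=
            (infDist_le_dist_of_mem hq).trans (dist_eq_norm z q ▸ norm_sub_le z q)
          have h2 := Real.log_le_sub_one_of_pos hpos
          simp only [hu] at hzC
          rw [mem_closedBall_zero_iff]
          nlinarith [le_abs_self C, abs_nonneg C, norm_nonneg z, norm_nonneg q]
        · have hpos := infDist_compl_pos hΩ ⟨q, hq⟩ hz
          simp only [hu] at hzC
          rw [mem_ofPred_eq, ← Real.le_log_iff_exp_le hpos]
          nlinarith [sq_nonneg ‖z‖]
    have heq : {z ∈ Ω | u z ≤ C} = K ∩ u ⁻¹' Iic C := by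
      ext z
      exact ⟨fun hz => ⟨hsub z hz.1 hz.2, hz.2⟩, fun hz => ⟨hKΩ hz.1, hz.2⟩⟩
    rw [heq]
    exact hK.of_isClosed_subset ((huc.mono hKΩ).preimage_isClosed_of_isClosed hK.isClosed
      isClosed_Iic) inter_subset_left

end Distance

end SCV

theorem mainTheorem8 (m : ℕ) (Ω : Set (SCV.Cn m)) (hΩ : SCV.IsWHHRDomain Ω) :
    SCV.IsTaut.{u} Ω ∧ SCV.IsPseudoconvex Ω := by
  obtain ⟨c, hc, h⟩ := hΩ.exists_localization
  have hloc : SCV.HasLocalization Ω c := h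
  exact ⟨hloc.isTaut hc, hloc.isPseudoconvex hc hΩ.isOpen⟩
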